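/- Conventions. MV-algebras are written $(M,\oplus,\neg,0)$, with $1=\neg 0$ and $a\odot b=\neg(\neg a\oplus\neg b)$; $a\le b$ means $\neg a\oplus b=1$. A unital Abelian $\ell$-group is an Abelian group with a translation-invariant lattice order and a distinguished element $1\ge 0$ such that every element lies below some multiple $n1$, $n\in\mathbb N$. For a unital Abelian $\ell$-group $G$, $\Gamma G=\{a\in G\mid 0\le a\le 1\}$ is the MV-algebra with $a\oplus b=(a+b)\wedge 1$ and $\neg a=1-a$. For an MV-algebra $M$, $A_M$ is the set of good sequences of $M$, i.e. sequences $(a_1,a_2,\dots)$ in $M$ with $a_i\oplus a_{i+1}=a_i$ for all $i$ and $a_i=0$ for all large $i$; with the addition $(a_i)_i+(b_i)_i=(a_i\oplus(a_{i-1}\odot b_1)\oplus\dots\oplus(a_1\odot b_{i-1})\oplus b_i)_i$ and the componentwise order it is a cancellative lattice-ordered commutative monoid. $\Xi M$ is the group of differences of $A_M$, with elements $[\mathbf a,\mathbf b]$, where $[\mathbf a,\mathbf b]=[\mathbf a',\mathbf b']$ iff $\mathbf a+\mathbf b'=\mathbf a'+\mathbf b$; it carries the unique translation-invariant lattice order extending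 that of $A_M$, and the unit $[(1),(0)]$, where $(a)$ denotes $(a,0,0,\dots)$. The map $a\mapsto[(a),(0)]$ embeds $M$ in $\Xi M$. Mundici's functors $\Gamma$ (unital Abelian $\ell$-groups with unital $\ell$-homomorphisms $\to$ MV-algebras with homomorphisms) and $\Xi$ (in the opposite direction) act on morphisms by restriction and by $[\mathbf a,\mathbf b]\mapsto[h(\mathbf a),h(\mathbf b)]$ ($h$ applied componentwise), respectively. A state $s\colon M\to N$ of MV-algebras is a function with $s(1)=1$ and $s(a\oplus b)=s(a)+s(b)$ in $\Xi N$ whenever $a\odot b=0$. A state $G\to H$ of unital Abelian $\ell$-groups is a group homomorphism that preserves $1$ and maps elements $\ge 0$ to elements $\ge 0$. Let $\mathsf{MV}_s$ and $\mathsf{A}_s$ be the categories of MV-algebras and of unital Abelian $\ell$-groups, respectively, with states as morphisms. Restriction of states to unit intervals makes $\Gamma$ a functor $\mathsf A_s\to\mathsf{MV}_s$. Theorem. (i) Every state $s\colon M\to N$ of MV-algebras has exactly one extension to a state $\Xi(s)\colon\Xi M\to\Xi N$, i.e. one with $\Xi(s)[(a),(0)]=[(s(a)),(0)]$ for all $a\in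 M$; hence $\Xi$ is a functor $\mathsf{MV}_s\to\mathsf A_s$. (ii) The functors $\Gamma\colon\mathsf A_s\to\mathsf{MV}_s$ and $\Xi\colon\mathsf{MV}_s\to\mathsf A_s$ extend Mundici's functors. (iii) They form an (adjoint) equivalence of categories, with natural isomorphisms $M\to\Gamma\Xi M$, $a\mapsto[(a),(0)]$, and $\epsilon_G\colon G\to\Xi\Gamma G$ satisfying $\epsilon_G(a)=[(a),(0)]$ for $a\in\Gamma G$. -/

import Mathlib

open CategoryTheory

universe u v

/-- MV-algebras `(M, ⊕, ¬, 0)`. -/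
class MVAlgebra (M : Type u) where
  oplus : M → M → M
  neg : M → M
  zero : M
  oplus_assoc : ∀ x y z, oplus (oplus x y) z = oplus x (oplus y z)
  oplus_comm : ∀ x y, oplus x y = oplus y x
  oplus_zero : ∀ x, oplus x zero = x
  neg_neg : ∀ x, neg (neg x) = x
  oplus_neg_zero : ∀ x, oplus x (neg zero) = neg zero
  neg_oplus_oplus : ∀ x y, oplus (neg (oplus (neg x) y)) y = oplus (neg (oplus (neg y) x)) x

namespace MVAlgebra

infixl:65 " ⊕ₘ " => MVAlgebra.oplus
prefix:max "∼ₘ" => MVAlgebra.neg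

variable {M : Type u} [MVAlgebra M]

/-- The top element `1 = ¬0`. -/
def one : M := ∼ₘzero

/-- `x ⊙ y = ¬(¬x ⊕ ¬y)`. -/
def odot (x y : M) : M := ∼ₘ(∼ₘx ⊕ₘ ∼ₘy)

infixl:70 " ⊙ₘ " => MVAlgebra.odot

instance : Std.Associative (oplus (M := M)) := ⟨oplus_assoc⟩
instance : Std.Commutative (oplus (M := M)) := ⟨oplus_comm⟩

theorem zero_oplus (x : M) : zero ⊕ₘ x = x := by rw [oplus_comm, oplus_zero]

theorem oplus_one (x : M) : x ⊕ₘ one = one := oplus_neg_zero x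

theorem one_oplus (x : M) : one ⊕ₘ x = one := by rw [oplus_comm, oplus_one]

theorem neg_one : ∼ₘ(one : M) = zero := neg_neg _

theorem neg_zero : ∼ₘ(zero : M) = one := rfl

theorem neg_inj {x y : M} (h : ∼ₘx = ∼ₘy) : x = y := by rw [← neg_neg x, h, neg_neg]

theorem odot_comm (x y : M) : x ⊙ₘ y = y ⊙ₘ x := by unfold odot; rw [oplus_comm]

theorem odot_assoc (x y z : M) : x ⊙ₘ y ⊙ₘ z = x ⊙ₘ (y ⊙ₘ z) := by
  unfold odot; rw [neg_neg, neg_neg, oplus_assoc]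

theorem neg_odot (x y : M) : ∼ₘ(x ⊙ₘ y) = ∼ₘx ⊕ₘ ∼ₘy := neg_neg _

theorem neg_oplus (x y : M) : ∼ₘ(x ⊕ₘ y) = ∼ₘx ⊙ₘ ∼ₘy := by unfold odot; rw [neg_neg, neg_neg]

theorem odot_one (x : M) : x ⊙ₘ one = x := by unfold odot; rw [neg_one, oplus_zero, neg_neg]

theorem one_odot (x : M) : one ⊙ₘ x = x := by rw [odot_comm, odot_one]

theorem odot_zero (x : M) : x ⊙ₘ zero = zero := by
  unfold odot; rw [neg_zero, oplus_one, neg_one]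

theorem zero_odot (x : M) : zero ⊙ₘ x = zero := by rw [odot_comm, odot_zero]

theorem neg_oplus_self (x : M) : ∼ₘx ⊕ₘ x = one := by
  have h := neg_oplus_oplus (one : M) x
  rwa [neg_one, zero_oplus, oplus_one] at h

/-- The natural order of an MV-algebra: `x ≤ y` when `¬x ⊕ y = 1`. -/
instance : LE M := ⟨fun x y => ∼ₘx ⊕ₘ y = one⟩

theorem le_def {x y : M} : x ≤ y ↔ ∼ₘx ⊕ₘ y = one := Iff.rfl

theorem le_oplus_right (x y : M) : x ≤ x ⊕ₘ y := by
  rw [le_def, ← oplus_assoc, neg_oplus_self, one_oplus]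

theorem sub_oplus_of_le {x y : M} (h : x ≤ y) : y ⊙ₘ ∼ₘx ⊕ₘ x = y := by
  have := neg_oplus_oplus x y
  rw [le_def.1 h, neg_one, zero_oplus] at this
  rw [odot, neg_neg]; exact this.symm

instance : PartialOrder M where
  le_refl x := neg_oplus_self x
  le_trans x y z h1 h2 := by
    rw [← sub_oplus_of_le h2, ← sub_oplus_of_le h1]
    have : z ⊙ₘ ∼ₘ(y ⊙ₘ ∼ₘx ⊕ₘ x) ⊕ₘ (y ⊙ₘ ∼ₘx ⊕ₘ x)
      = x ⊕ₘ (z ⊙ₘ ∼ₘ(y ⊙ₘ ∼ₘx ⊕ₘ x) ⊕ₘ y ⊙ₘ ∼ₘx) := by ac_rfl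
    rw [this]; exact le_oplus_right _ _
  le_antisymm x y h1 h2 := by
    have h := sub_oplus_of_le h1
    rw [odot, neg_neg, le_def.1 h2, neg_one, zero_oplus] at h
    exact h

theorem le_oplus_left (x y : M) : y ≤ x ⊕ₘ y := by rw [oplus_comm]; exact le_oplus_right _ _

theorem oplus_le_oplus_right {x y : M} (h : x ≤ y) (z : M) : x ⊕ₘ z ≤ y ⊕ₘ z := by
  rw [← sub_oplus_of_le h, oplus_assoc]; exact le_oplus_left _ _

theorem oplus_le_oplus {x y z w : M} (h : x ≤ y) (h' : z ≤ w) : x ⊕ₘ z ≤ y ⊕ₘ w := by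
  refine (oplus_le_oplus_right h z).trans ?_
  rw [oplus_comm y, oplus_comm y]; exact oplus_le_oplus_right h' y

theorem neg_le_neg {x y : M} (h : x ≤ y) : ∼ₘy ≤ ∼ₘx := by
  rw [le_def, neg_neg, oplus_comm]; exact h

theorem sub_le_iff {x y z : M} : x ⊙ₘ ∼ₘy ≤ z ↔ x ≤ y ⊕ₘ z := by
  rw [le_def, le_def, neg_odot, neg_neg, oplus_assoc]

theorem odot_le_odot {x y z w : M} (h : x ≤ y) (h' : z ≤ w) : x ⊙ₘ z ≤ y ⊙ₘ w :=
  neg_le_neg (oplus_le_oplus (neg_le_neg h) (neg_le_neg h'))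

theorem le_one (x : M) : x ≤ one := oplus_one _

theorem zero_le (x : M) : zero ≤ x := one_oplus _

theorem eq_zero_of_le {x : M} (h : x ≤ zero) : x = zero := le_antisymm h (zero_le x)

theorem eq_one_of_le {x : M} (h : one ≤ x) : x = one := le_antisymm (le_one x) h

theorem odot_le_left (x y : M) : x ⊙ₘ y ≤ x := by
  have := odot_le_odot (le_refl x) (le_one y); rwa [odot_one] at this

theorem odot_le_right (x y : M) : x ⊙ₘ y ≤ y := by rw [odot_comm]; exact odot_le_left _ _

theorem odot_eq_zero {x y : M} : x ⊙ₘ y = zero ↔ x ≤ ∼ₘy := by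
  rw [le_def, odot]
  constructor
  · intro h; rw [← neg_neg (_ ⊕ₘ _), h, neg_zero]
  · intro h; rw [h, neg_one]

theorem oplus_eq_one {x y : M} : x ⊕ₘ y = one ↔ ∼ₘx ≤ y := by rw [le_def, neg_neg]

theorem sub_eq_zero {x y : M} : x ⊙ₘ ∼ₘy = zero ↔ x ≤ y := by rw [odot_eq_zero, neg_neg]

theorem odot_neg_self (x : M) : x ⊙ₘ ∼ₘx = zero := sub_eq_zero.2 le_rfl

/-- The lattice operations `x ∨ y = (x ⊙ ¬y) ⊕ y` and `x ∧ y = ¬(¬x ∨ ¬y)`. -/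
instance : Lattice M where
  sup x y := x ⊙ₘ ∼ₘy ⊕ₘ y
  inf x y := ∼ₘ(∼ₘx ⊙ₘ ∼ₘ∼ₘy ⊕ₘ ∼ₘy)
  le_sup_right x y := le_oplus_left _ _
  le_sup_left x y := by
    have := neg_oplus_oplus x y
    simp only [odot, neg_neg]; rw [this]; exact le_oplus_left _ _
  sup_le x y z h1 h2 := by
    rw [← sub_oplus_of_le h2]
    exact oplus_le_oplus_right (odot_le_odot h1 le_rfl) _
  inf_le_right x y := by
    have := neg_le_neg (le_oplus_left (∼ₘx ⊙ₘ ∼ₘ∼ₘy) (∼ₘy))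
    rwa [neg_neg y] at this ⊢
  inf_le_left x y := by
    have h : ∼ₘx ≤ ∼ₘx ⊙ₘ ∼ₘ∼ₘy ⊕ₘ ∼ₘy := by
      have := neg_oplus_oplus (∼ₘx) (∼ₘy)
      simp only [odot, neg_neg] at this ⊢; rw [this]; exact le_oplus_left _ _
    have := neg_le_neg h
    rwa [neg_neg x] at this
  le_inf x y z h1 h2 := by
    have h : ∼ₘy ⊙ₘ ∼ₘ∼ₘz ⊕ₘ ∼ₘz ≤ ∼ₘx := by
      rw [← sub_oplus_of_le (neg_le_neg h2)]
      exact oplus_le_oplus_right (odot_le_odot (neg_le_neg h1) le_rfl) _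
    have := neg_le_neg h
    rwa [neg_neg x] at this

theorem sup_def (x y : M) : x ⊔ y = x ⊙ₘ ∼ₘy ⊕ₘ y := rfl

theorem inf_eq (x y : M) : x ⊓ y = y ⊙ₘ (∼ₘy ⊕ₘ x) := by
  change ∼ₘ(∼ₘx ⊙ₘ ∼ₘ∼ₘy ⊕ₘ ∼ₘy) = _
  rw [neg_oplus, neg_odot, neg_neg, neg_neg, odot_comm, oplus_comm, neg_neg]

theorem neg_sup (x y : M) : ∼ₘ(x ⊔ y) = ∼ₘx ⊓ ∼ₘy := by
  change _ = ∼ₘ(∼ₘ∼ₘx ⊙ₘ ∼ₘ∼ₘ∼ₘy ⊕ₘ ∼ₘ∼ₘy)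
  rw [neg_neg, neg_neg, neg_neg, sup_def]

theorem inf_oplus_le (a b c : M) : a ⊓ (b ⊕ₘ c) ≤ (a ⊓ b) ⊕ₘ (a ⊓ c) := by
  set z := a ⊓ (b ⊕ₘ c)
  have hz : z ≤ a := inf_le_left
  have hz' : z ≤ b ⊕ₘ c := inf_le_right
  have h1 : z ⊙ₘ ∼ₘc ≤ a ⊓ b :=
    le_inf ((odot_le_left _ _).trans hz) (sub_le_iff.2 (by rwa [oplus_comm]))
  rw [sub_le_iff, oplus_comm, ← sub_le_iff] at h1
  exact sub_le_iff.1 (le_inf ((odot_le_left _ _).trans hz) h1)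

theorem sub_inf_sub (x y : M) : (x ⊙ₘ ∼ₘy) ⊓ (y ⊙ₘ ∼ₘx) = zero := by
  set p := x ⊙ₘ ∼ₘy with hp
  set w := ∼ₘy ⊕ₘ p with hw
  have e1 : p ⊓ (y ⊙ₘ ∼ₘx) = y ⊙ₘ (∼ₘx ⊙ₘ (x ⊕ₘ w)) := by
    rw [inf_eq, neg_odot, neg_neg, odot_assoc, hw]; congr 2; ac_rfl
  have e2 : ∼ₘx ⊙ₘ (x ⊕ₘ w) = w ⊙ₘ (∼ₘw ⊕ₘ ∼ₘx) := by
    have := inf_eq w (∼ₘx)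
    rw [neg_neg] at this
    rw [← this, inf_comm, inf_eq]
  have e3 : y ⊙ₘ w = p ⊙ₘ (∼ₘp ⊕ₘ y) := by rw [hw, ← inf_eq, inf_comm, inf_eq]
  have e4 : x ⊙ₘ (∼ₘw ⊕ₘ ∼ₘx) ≤ y := by
    rw [oplus_comm, ← inf_eq]
    refine inf_le_left.trans ?_
    rw [hw, neg_oplus, neg_neg]; exact odot_le_left _ _
  apply eq_zero_of_le
  rw [e1, e2, ← odot_assoc, e3, ← odot_neg_self y]
  calc p ⊙ₘ (∼ₘp ⊕ₘ y) ⊙ₘ (∼ₘw ⊕ₘ ∼ₘx)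
      ≤ p ⊙ₘ (∼ₘw ⊕ₘ ∼ₘx) := odot_le_odot (odot_le_left _ _) le_rfl
    _ = (x ⊙ₘ (∼ₘw ⊕ₘ ∼ₘx)) ⊙ₘ ∼ₘy := by
      rw [hp, odot_assoc, odot_comm (∼ₘy), odot_assoc]
    _ ≤ _ := odot_le_odot e4 le_rfl

/-- Cancellation of disjoint sums. -/
theorem oplus_sub_of_disjoint {x y : M} (h : x ⊙ₘ y = zero) : (x ⊕ₘ y) ⊙ₘ ∼ₘy = x := by
  have := inf_eq x (∼ₘy)
  rw [neg_neg, inf_eq_left.2 (odot_eq_zero.1 h)] at this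
  rw [odot_comm, oplus_comm]; exact this.symm

theorem odot_swap₁ {a b c : M} (h1 : a ⊙ₘ b = zero) (h2 : b ⊕ₘ c = one) :
    (a ⊕ₘ b) ⊙ₘ c = a ⊕ₘ (b ⊙ₘ c) := by
  have e1 : b ⊙ₘ c ⊕ₘ ∼ₘc = b := by
    have := sub_oplus_of_le (x := ∼ₘc) (y := b)
      (by rw [oplus_comm] at h2; exact oplus_eq_one.1 h2)
    rwa [neg_neg] at this
  have e2 : ∼ₘb ⊕ₘ b ⊙ₘ c = c := by
    have := sub_oplus_of_le (oplus_eq_one.1 h2)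
    rwa [neg_neg, oplus_comm, odot_comm] at this
  have e3 : (a ⊕ₘ b ⊙ₘ c) ⊙ₘ ∼ₘc = zero := by
    rw [sub_eq_zero]
    calc _ ≤ ∼ₘb ⊕ₘ b ⊙ₘ c := oplus_le_oplus_right (odot_eq_zero.1 h1) _
      _ = c := e2
  have := oplus_sub_of_disjoint e3
  rwa [oplus_assoc, e1, neg_neg] at this

theorem odot_swap₂ {a b c : M} (h1 : a ⊙ₘ b = zero) (h2 : b ⊙ₘ c = zero)
    (h3 : a ⊕ₘ b ⊕ₘ c = one) : (a ⊕ₘ b) ⊙ₘ c = a ⊙ₘ (b ⊕ₘ c) := by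
  set r := (a ⊕ₘ b) ⊙ₘ c with hr
  have e1 : r ⊕ₘ ∼ₘ(a ⊕ₘ b) = c := by
    have := sub_oplus_of_le (oplus_eq_one.1 h3)
    rwa [neg_neg, odot_comm c] at this
  have hab : b ≤ ∼ₘa := by rw [odot_comm] at h1; exact odot_eq_zero.1 h1
  have e2 : ∼ₘ(a ⊕ₘ b) ⊕ₘ b = ∼ₘa := by
    rw [neg_oplus]; exact sub_oplus_of_le hab
  have e3 : ∼ₘ(a ⊕ₘ b) ⊕ₘ a = ∼ₘb := by
    rw [oplus_comm a, neg_oplus]; exact sub_oplus_of_le (odot_eq_zero.1 h1)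
  have e4 : b ⊕ₘ c = r ⊕ₘ ∼ₘa := by rw [← e1, ← e2]; ac_rfl
  have e5 : r ≤ a := by
    have : c ⊙ₘ ∼ₘ∼ₘ(a ⊕ₘ b) ≤ a := by
      rw [sub_le_iff, e3]; rw [odot_comm] at h2; exact odot_eq_zero.1 h2
    rwa [neg_neg, odot_comm] at this
  have := oplus_sub_of_disjoint (sub_eq_zero.2 e5)
  rw [← e4, neg_neg] at this
  rw [odot_comm a]; exact this.symm

end MVAlgebra

/-- Homomorphisms of MV-algebras. -/
@[ext]
structure MVHom (M : Type u) (N : Type v) [MVAlgebra M] [MVAlgebra N] where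
  toFun : M → N
  map_oplus : ∀ x y, toFun (x ⊕ₘ y) = toFun x ⊕ₘ toFun y
  map_neg : ∀ x, toFun ∼ₘx = ∼ₘ(toFun x)
  map_zero : toFun MVAlgebra.zero = MVAlgebra.zero

namespace MVHom

variable {M : Type u} {N : Type v} [MVAlgebra M] [MVAlgebra N]

instance : CoeFun (MVHom M N) (fun _ => M → N) := ⟨MVHom.toFun⟩

theorem map_one (f : MVHom M N) : f MVAlgebra.one = MVAlgebra.one := by
  rw [MVAlgebra.one, f.map_neg, f.map_zero]; rfl

theorem map_odot (f : MVHom M N) (x y : M) : f (x ⊙ₘ y) = f x ⊙ₘ f y := by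
  simp only [MVAlgebra.odot, f.map_neg, f.map_oplus]

theorem map_sup (f : MVHom M N) (x y : M) : f (x ⊔ y) = f x ⊔ f y := by
  simp only [MVAlgebra.sup_def, f.map_odot, f.map_neg, f.map_oplus]

theorem map_inf (f : MVHom M N) (x y : M) : f (x ⊓ y) = f x ⊓ f y := by
  simp only [MVAlgebra.inf_eq, f.map_odot, f.map_neg, f.map_oplus]

theorem map_le (f : MVHom M N) {x y : M} (h : x ≤ y) : f x ≤ f y := by
  rw [MVAlgebra.le_def, ← f.map_neg, ← f.map_oplus, MVAlgebra.le_def.1 h, f.map_one]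

end MVHom

namespace MVAlgebra

section Chains

variable {M : Type u} [MVAlgebra M]

/-- Ideals of an MV-algebra. -/
structure IsIdeal (I : Set M) : Prop where
  zero_mem : zero ∈ I
  oplus_mem : ∀ {x y}, x ∈ I → y ∈ I → x ⊕ₘ y ∈ I
  of_le : ∀ {x y}, x ≤ y → y ∈ I → x ∈ I

theorem IsIdeal.quot {I : Set M} (hI : IsIdeal I) (q : M) : IsIdeal {w | w ⊓ q ∈ I} where
  zero_mem := hI.of_le inf_le_left hI.zero_mem
  oplus_mem {x y} hx hy := by
    refine hI.of_le ?_ (hI.oplus_mem hx hy)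
    rw [inf_comm, inf_comm x, inf_comm y]; exact inf_oplus_le _ _ _
  of_le {x y} hxy hy := hI.of_le (inf_le_inf_right q hxy) hy

theorem exists_prime {a : M} (ha : a ≠ zero) :
    ∃ I : Set M, IsIdeal I ∧ a ∉ I ∧ ∀ x y, x ⊙ₘ ∼ₘy ∈ I ∨ y ⊙ₘ ∼ₘx ∈ I := by
  obtain ⟨I, -, hI⟩ := zorn_subset_nonempty {I : Set M | IsIdeal I ∧ a ∉ I} (by
      intro c hc hch hne
      obtain ⟨J, hJ⟩ := hne
      refine ⟨⋃₀ c, ⟨⟨⟨J, hJ, (hc hJ).1.zero_mem⟩, ?_, ?_⟩, ?_⟩,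
        fun s hs => Set.subset_sUnion_of_mem hs⟩
      · rintro x y ⟨A, hA, hx⟩ ⟨B, hB, hy⟩
        rcases hch.total hA hB with h | h
        · exact ⟨B, hB, (hc hB).1.oplus_mem (h hx) hy⟩
        · exact ⟨A, hA, (hc hA).1.oplus_mem hx (h hy)⟩
      · rintro x y hxy ⟨B, hB, hy⟩
        exact ⟨B, hB, (hc hB).1.of_le hxy hy⟩
      · rintro ⟨A, hA, h⟩
        exact (hc hA).2 h) {zero}
    ⟨⟨rfl, by rintro x y rfl rfl; exact oplus_zero _, by
      rintro x y h rfl; exact eq_zero_of_le h⟩, ha⟩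
  refine ⟨I, hI.prop.1, hI.prop.2, fun x y => ?_⟩
  by_contra! hcon
  have hle : ∀ q, I ⊆ {w | w ⊓ q ∈ I} := fun q w hw => hI.prop.1.of_le inf_le_left hw
  have h1 : a ⊓ (y ⊙ₘ ∼ₘx) ∈ I := by
    by_contra h
    refine hcon.1 (hI.le_of_ge ⟨hI.prop.1.quot _, h⟩ (hle _) ?_)
    change _ ⊓ _ ∈ I
    rw [sub_inf_sub]; exact hI.prop.1.zero_mem
  refine hcon.2 (hI.le_of_ge ⟨hI.prop.1.quot a, ?_⟩ (hle _) ?_)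
  · change ¬ (a ⊓ a ∈ I)
    rw [inf_idem]; exact hI.prop.2
  · change _ ⊓ a ∈ I
    rwa [inf_comm]

/-- The congruence of an ideal. -/
def idealSetoid {I : Set M} (hI : IsIdeal I) : Setoid M where
  r x y := x ⊙ₘ ∼ₘy ∈ I ∧ y ⊙ₘ ∼ₘx ∈ I
  iseqv := by
    have tr : ∀ {x y z : M}, x ⊙ₘ ∼ₘy ∈ I → y ⊙ₘ ∼ₘz ∈ I → x ⊙ₘ ∼ₘz ∈ I := by
      intro x y z h1 h2
      refine hI.of_le ?_ (hI.oplus_mem h1 h2)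
      rw [sub_le_iff]
      have a1 : x ≤ y ⊕ₘ x ⊙ₘ ∼ₘy := sub_le_iff.1 le_rfl
      have a2 : y ≤ z ⊕ₘ y ⊙ₘ ∼ₘz := sub_le_iff.1 le_rfl
      refine (a1.trans (oplus_le_oplus_right a2 _)).trans (le_of_eq ?_)
      ac_rfl
    exact ⟨fun x => ⟨by rw [odot_neg_self]; exact hI.zero_mem,
        by rw [odot_neg_self]; exact hI.zero_mem⟩,
      fun h => ⟨h.2, h.1⟩, fun h h' => ⟨tr h.1 h'.1, tr h'.2 h.2⟩⟩

theorem ideal_oplus {I : Set M} (hI : IsIdeal I) {x y z w : M} (h : x ⊙ₘ ∼ₘy ∈ I)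
    (h' : z ⊙ₘ ∼ₘw ∈ I) : (x ⊕ₘ z) ⊙ₘ ∼ₘ(y ⊕ₘ w) ∈ I := by
  refine hI.of_le ?_ (hI.oplus_mem h h')
  rw [sub_le_iff]
  have a1 : x ≤ y ⊕ₘ x ⊙ₘ ∼ₘy := sub_le_iff.1 le_rfl
  have a2 : z ≤ w ⊕ₘ z ⊙ₘ ∼ₘw := sub_le_iff.1 le_rfl
  refine (oplus_le_oplus a1 a2).trans (le_of_eq ?_)
  ac_rfl

/-- The quotient of an MV-algebra by an ideal. -/
instance idealQuotient {I : Set M} (hI : IsIdeal I) : MVAlgebra (Quotient (idealSetoid hI)) where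
  oplus := Quotient.map₂ oplus (fun _ _ h _ _ h' =>
    ⟨ideal_oplus hI h.1 h'.1, ideal_oplus hI h.2 h'.2⟩)
  neg := Quotient.map neg (fun x y h => by
    refine ⟨?_, ?_⟩
    · rw [odot_comm, neg_neg]; exact h.2
    · rw [odot_comm, neg_neg]; exact h.1)
  zero := Quotient.mk _ zero
  oplus_assoc := by
    rintro ⟨x⟩ ⟨y⟩ ⟨z⟩; exact congrArg (Quotient.mk _) (oplus_assoc x y z)
  oplus_comm := by rintro ⟨x⟩ ⟨y⟩; exact congrArg (Quotient.mk _) (oplus_comm x y)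
  oplus_zero := by rintro ⟨x⟩; exact congrArg (Quotient.mk _) (oplus_zero x)
  neg_neg := by rintro ⟨x⟩; exact congrArg (Quotient.mk _) (neg_neg x)
  oplus_neg_zero := by rintro ⟨x⟩; exact congrArg (Quotient.mk _) (oplus_neg_zero x)
  neg_oplus_oplus := by
    rintro ⟨x⟩ ⟨y⟩; exact congrArg (Quotient.mk _) (neg_oplus_oplus x y)

/-- Nonzero elements survive in some totally ordered quotient. -/
theorem exists_chain {a : M} (ha : a ≠ zero) :
    ∃ (C : Type u) (_ : MVAlgebra C) (f : MVHom M C),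
      (∀ x y : C, x ≤ y ∨ y ≤ x) ∧ f a ≠ zero := by
  obtain ⟨I, hI, haI, hp⟩ := exists_prime ha
  have key : ∀ x : M, (Quotient.mk (idealSetoid hI) x) = zero ↔ x ∈ I := by
    intro x
    refine Quotient.eq.trans ?_
    change x ⊙ₘ ∼ₘzero ∈ I ∧ zero ⊙ₘ ∼ₘx ∈ I ↔ _
    rw [neg_zero, odot_one, zero_odot]
    exact ⟨fun h => h.1, fun h => ⟨h, hI.zero_mem⟩⟩
  refine ⟨_, idealQuotient hI, ⟨Quotient.mk _, fun _ _ => rfl, fun _ => rfl, rfl⟩, ?_, ?_⟩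
  · rintro ⟨x⟩ ⟨y⟩
    exact (hp x y).imp (fun h => sub_eq_zero.1 ((key _).2 h)) (fun h => sub_eq_zero.1 ((key _).2 h))
  · exact fun h => haI ((key a).1 h)

theorem le_of_chains {x y : M} (h : ∀ (C : Type u) (_ : MVAlgebra C) (f : MVHom M C),
    (∀ x y : C, x ≤ y ∨ y ≤ x) → f x ≤ f y) : x ≤ y := by
  rw [← sub_eq_zero]
  by_contra hne
  obtain ⟨C, _, f, ht, hf⟩ := exists_chain hne
  apply hf
  rw [f.map_odot, f.map_neg, sub_eq_zero]
  exact h C _ f ht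

theorem eq_of_chains {x y : M} (h : ∀ (C : Type u) (_ : MVAlgebra C) (f : MVHom M C),
    (∀ x y : C, x ≤ y ∨ y ≤ x) → f x = f y) : x = y :=
  le_antisymm (le_of_chains fun C i f ht => (h C i f ht).le)
    (le_of_chains fun C i f ht => (h C i f ht).ge)

end Chains

end MVAlgebra

namespace MVAlgebra

section GoodSequences

variable {M : Type u} [MVAlgebra M]

/-- `(a₁, a₂, …)` is good if `aᵢ ⊕ aᵢ₊₁ = aᵢ` for all `i` and `aᵢ = 0` eventually.
Sequences are indexed from `0` here. -/
def IsGood (a : ℕ → M) : Prop :=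
  (∀ i, a i ⊕ₘ a (i + 1) = a i) ∧ ∃ n, ∀ i, n ≤ i → a i = zero

/-- The iterated sum `f 0 ⊕ ⋯ ⊕ f (n - 1)`. -/
def osum (f : ℕ → M) : ℕ → M
  | 0 => zero
  | n + 1 => osum f n ⊕ₘ f n

/-- The `i`-th entry of the sum of two sequences (indexed from `0`):
`aᵢ ⊕ (aᵢ₋₁ ⊙ b₀) ⊕ ⋯ ⊕ (a₀ ⊙ bᵢ₋₁) ⊕ bᵢ`. -/
def seqAdd (a b : ℕ → M) (i : ℕ) : M :=
  a i ⊕ₘ osum (fun k => a (i - 1 - k) ⊙ₘ b k) i ⊕ₘ b i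

theorem osum_eq_zero {f : ℕ → M} {n : ℕ} (h : ∀ k < n, f k = zero) : osum f n = zero := by
  induction n with
  | zero => rfl
  | succ n ih =>
    rw [osum, ih fun k hk => h k (by omega), h n (by omega), oplus_zero]

theorem osum_stable {f : ℕ → M} {n N : ℕ} (hn : n ≤ N) (h : ∀ k, n ≤ k → k < N → f k = zero) :
    osum f N = osum f n := by
  induction N, hn using Nat.le_induction with
  | base => rfl
  | succ N hN ih =>
    rw [osum, ih fun k h1 h2 => h k h1 (by omega), h N hN (by omega), oplus_zero]

theorem le_osum {f : ℕ → M} {k n : ℕ} (h : k < n) : f k ≤ osum f n := by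
  induction n with
  | zero => omega
  | succ n ih =>
    rcases Nat.lt_succ_iff_lt_or_eq.1 h with h | rfl
    · exact (ih h).trans (le_oplus_right _ _)
    · exact le_oplus_left _ _

theorem osum_mono {f g : ℕ → M} (h : ∀ k, f k ≤ g k) (n : ℕ) : osum f n ≤ osum g n := by
  induction n with
  | zero => exact le_rfl
  | succ n ih => exact oplus_le_oplus ih (h n)

theorem seqAdd_mono {a b c : ℕ → M} (h : ∀ i, a i ≤ b i) (i : ℕ) :
    seqAdd a c i ≤ seqAdd b c i :=
  oplus_le_oplus_right
    (oplus_le_oplus (h i) (osum_mono (fun _ => odot_le_odot (h _) le_rfl) i)) _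

theorem map_osum {N : Type v} [MVAlgebra N] (f : MVHom M N) (g : ℕ → M) (n : ℕ) :
    f (osum g n) = osum (fun k => f (g k)) n := by
  induction n with
  | zero => exact f.map_zero
  | succ n ih => rw [osum, f.map_oplus, ih]; rfl

theorem map_seqAdd {N : Type v} [MVAlgebra N] (f : MVHom M N) (a b : ℕ → M) (i : ℕ) :
    f (seqAdd a b i) = seqAdd (fun k => f (a k)) (fun k => f (b k)) i := by
  simp only [seqAdd, f.map_oplus, map_osum, f.map_odot]

theorem IsGood.map {N : Type v} [MVAlgebra N] (f : MVHom M N) {a : ℕ → M} (h : IsGood a) :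
    IsGood (fun k => f (a k)) := by
  refine ⟨fun i => by rw [← f.map_oplus, h.1], ?_⟩
  obtain ⟨n, hn⟩ := h.2
  exact ⟨n, fun i hi => by simp only [hn i hi, f.map_zero]⟩

/-- The sequence `(1, …, 1, ξ, 0, 0, …)` with `m` ones. -/
def nf (m : ℕ) (ξ : M) (i : ℕ) : M := if i < m then one else if i = m then ξ else zero

theorem nf_lt {m i : ℕ} {ξ : M} (h : i < m) : nf m ξ i = one := if_pos h

theorem nf_self (m : ℕ) (ξ : M) : nf m ξ m = ξ := by simp [nf]

theorem nf_gt {m i : ℕ} {ξ : M} (h : m < i) : nf m ξ i = zero := by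
  simp [nf, h.not_gt, h.ne']

theorem isGood_nf (m : ℕ) (ξ : M) : IsGood (nf m ξ) := by
  refine ⟨fun i => ?_, m + 1, fun i hi => nf_gt hi⟩
  rcases lt_trichotomy i m with h | h | h
  · rw [nf_lt h, one_oplus]
  · rw [nf_gt (show m < i + 1 by omega), oplus_zero]
  · rw [nf_gt (show m < i + 1 by omega), oplus_zero]

theorem seqAdd_nf_lt {m n i : ℕ} {ξ η : M} (h : i < m + n) :
    seqAdd (nf m ξ) (nf n η) i = one := by
  apply eq_one_of_le
  unfold seqAdd
  by_cases hm : i < m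
  · rw [nf_lt hm, oplus_assoc]; exact le_oplus_right _ _
  by_cases hn : i < n
  · rw [nf_lt hn]; exact le_oplus_left _ _
  refine le_trans ?_ (le_oplus_right _ _)
  refine le_trans ?_ (le_oplus_left _ _)
  refine le_trans (le_of_eq ?_)
    (le_osum (f := fun k => nf m ξ (i - 1 - k) ⊙ₘ nf n η k) (show n - 1 < i by omega))
  rw [nf_lt (show i - 1 - (n - 1) < m by omega), nf_lt (show n - 1 < n by omega), odot_one]

theorem seqAdd_nf_eq (m n : ℕ) (ξ η : M) :
    seqAdd (nf m ξ) (nf n η) (m + n) = ξ ⊕ₘ η := by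
  have hz : ∀ k, n + 1 ≤ k → k < m + n →
      nf m ξ (m + n - 1 - k) ⊙ₘ nf n η k = zero := fun k h1 _ => by
    rw [nf_gt (m := n) (by omega), odot_zero]
  have hz' : ∀ k, k < n - 1 → nf m ξ (m + n - 1 - k) ⊙ₘ nf n η k = zero := fun k h1 => by
    rw [nf_gt (m := m) (by omega), zero_odot]
  unfold seqAdd
  rcases Nat.eq_zero_or_pos m with rfl | hm <;> rcases Nat.eq_zero_or_pos n with rfl | hn
  · simp [osum, nf_self, oplus_zero]
  · obtain ⟨n, rfl⟩ := Nat.exists_eq_succ_of_ne_zero hn.ne'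
    rw [nf_gt (m := 0) (by omega), zero_oplus, Nat.zero_add, nf_self, osum, osum_eq_zero]
    · rw [show n.succ - 1 - n = 0 by omega, nf_self, nf_lt (Nat.lt_succ_self n), odot_one,
        zero_oplus]
    · intro k hk
      have := hz' k (by omega)
      rwa [Nat.zero_add] at this
  · rw [Nat.add_zero, nf_self, nf_gt (m := 0) hm, oplus_zero, osum_stable (n := 1) hm, osum, osum,
      zero_oplus, nf_lt (show m - 1 - 0 < m by omega), nf_self, one_odot]
    intro k h1 h2
    exact hz k (by omega) (by omega)
  · rw [nf_gt (m := m) (by omega), nf_gt (m := n) (by omega), zero_oplus, oplus_zero,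
      osum_stable (n := n + 1) (by omega) hz]
    obtain ⟨n, rfl⟩ := Nat.exists_eq_succ_of_ne_zero hn.ne'
    rw [osum, osum, osum_eq_zero (fun k hk => hz' k (by omega)), zero_oplus,
      show m + n.succ - 1 - n = m by omega, nf_self, nf_lt (Nat.lt_succ_self n), odot_one,
      nf_lt (show m + n.succ - 1 - n.succ < m by omega), nf_self, one_odot]

theorem seqAdd_nf_succ (m n : ℕ) (ξ η : M) :
    seqAdd (nf m ξ) (nf n η) (m + n + 1) = ξ ⊙ₘ η := by
  unfold seqAdd
  rw [nf_gt (m := m) (by omega), nf_gt (m := n) (by omega), zero_oplus, oplus_zero,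
    osum_stable (n := n + 1) (by omega), osum, osum_eq_zero, zero_oplus,
    show m + n + 1 - 1 - n = m by omega, nf_self, nf_self]
  · intro k hk
    rw [nf_gt (m := m) (by omega), zero_odot]
  · intro k h1 _
    rw [nf_gt (m := n) (by omega), odot_zero]

theorem seqAdd_nf_gt {m n i : ℕ} {ξ η : M} (h : m + n + 1 < i) :
    seqAdd (nf m ξ) (nf n η) i = zero := by
  unfold seqAdd
  rw [nf_gt (m := m) (by omega), nf_gt (m := n) (by omega), zero_oplus, oplus_zero, osum_eq_zero]
  intro k hk
  by_cases hkn : n < k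
  · rw [nf_gt hkn, odot_zero]
  · rw [nf_gt (m := m) (by omega), zero_odot]

theorem seqAdd_nf_carry {m n : ℕ} {ξ η : M} (h : ξ ⊕ₘ η = one) :
    seqAdd (nf m ξ) (nf n η) = nf (m + n + 1) (ξ ⊙ₘ η) := by
  funext i
  rcases lt_trichotomy i (m + n) with h1 | rfl | h1
  · rw [seqAdd_nf_lt h1, nf_lt (by omega)]
  · rw [seqAdd_nf_eq, nf_lt (by omega), h]
  · rcases Nat.eq_or_lt_of_le (Nat.succ_le_of_lt h1) with rfl | h2
    · rw [Nat.succ_eq_add_one, seqAdd_nf_succ, nf_self]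
    · rw [seqAdd_nf_gt h2, nf_gt h2]

theorem seqAdd_nf_disjoint {m n : ℕ} {ξ η : M} (h : ξ ⊙ₘ η = zero) :
    seqAdd (nf m ξ) (nf n η) = nf (m + n) (ξ ⊕ₘ η) := by
  funext i
  rcases lt_trichotomy i (m + n) with h1 | rfl | h1
  · rw [seqAdd_nf_lt h1, nf_lt (by omega)]
  · rw [seqAdd_nf_eq, nf_self]
  · rw [nf_gt h1]
    rcases Nat.eq_or_lt_of_le (Nat.succ_le_of_lt h1) with rfl | h2
    · rw [Nat.succ_eq_add_one, seqAdd_nf_succ, h]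
    · rw [seqAdd_nf_gt h2]

/-! Totally ordered MV-algebras. -/

theorem disjoint_of_ne_one (ht : ∀ x y : M, x ≤ y ∨ y ≤ x) {x y : M} (h : x ⊕ₘ y ≠ one) :
    x ⊙ₘ y = zero := by
  rw [odot_eq_zero]
  rcases ht x (∼ₘy) with h1 | h1
  · exact h1
  · rw [oplus_comm] at h; exact absurd (oplus_eq_one.2 h1) h

theorem exists_nf (ht : ∀ x y : M, x ≤ y ∨ y ≤ x) (h01 : (one : M) ≠ zero) {a : ℕ → M}
    (ha : IsGood a) : ∃ m ξ, ξ ≠ one ∧ a = nf m ξ := by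
  classical
  have hex : ∃ m, a m ≠ one := by
    obtain ⟨n, hn⟩ := ha.2
    exact ⟨n, by rw [hn n le_rfl]; exact h01.symm⟩
  have hm := Nat.find_spec hex
  set m := Nat.find hex with hmdef
  refine ⟨m, a m, hm, ?_⟩
  have hgt : ∀ j, a (m + 1 + j) = zero := by
    intro j
    induction j with
    | zero =>
      have h1 := ha.1 m
      have h2 : a (m + 1) ⊙ₘ a m = zero :=
        disjoint_of_ne_one ht (by rw [oplus_comm, h1]; exact hm)
      have h3 := oplus_sub_of_disjoint h2
      rw [oplus_comm, h1, odot_neg_self] at h3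
      exact h3.symm
    | succ j ih =>
      have h1 := ha.1 (m + 1 + j)
      rwa [ih, zero_oplus] at h1
  funext i
  rcases lt_trichotomy i m with h | h | h
  · rw [nf_lt h]
    by_contra hne
    exact absurd (Nat.find_min' hex hne) (by omega)
  · subst h; rw [nf_self]
  · rw [nf_gt h]
    obtain ⟨j, rfl⟩ := Nat.exists_eq_add_of_le (Nat.succ_le_of_lt h)
    exact hgt j

theorem nf_inj {m n : ℕ} {ξ η : M} (hξ : ξ ≠ one) (hη : η ≠ one) (h : nf m ξ = nf n η) :
    m = n ∧ ξ = η := by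
  have e : m = n := by
    rcases lt_trichotomy m n with h1 | h1 | h1
    · have := congrFun h m
      rw [nf_self, nf_lt h1] at this
      exact absurd this hξ
    · exact h1
    · have := congrFun h n
      rw [nf_self, nf_lt h1] at this
      exact absurd this.symm hη
  subst e
  have := congrFun h m
  rw [nf_self, nf_self] at this
  exact ⟨rfl, this⟩

theorem odot_ne_one {x y : M} (hx : x ≠ one) : x ⊙ₘ y ≠ one := fun h =>
  hx (eq_one_of_le (h ▸ odot_le_left x y))

theorem subsingleton_of_eq (h : (one : M) = zero) (x y : M) : x = y := by
  rw [← odot_one x, ← odot_one y, h, odot_zero, odot_zero]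

theorem seqAdd_good_chain (ht : ∀ x y : M, x ≤ y ∨ y ≤ x) {a b : ℕ → M} (ha : IsGood a)
    (hb : IsGood b) : IsGood (seqAdd a b) := by
  by_cases h01 : (one : M) = zero
  · exact ⟨fun _ => subsingleton_of_eq h01 _ _, 0, fun _ _ => subsingleton_of_eq h01 _ _⟩
  obtain ⟨m, ξ, hξ, rfl⟩ := exists_nf ht h01 ha
  obtain ⟨n, η, hη, rfl⟩ := exists_nf ht h01 hb
  by_cases h : ξ ⊕ₘ η = one
  · rw [seqAdd_nf_carry h]; exact isGood_nf _ _
  · rw [seqAdd_nf_disjoint (disjoint_of_ne_one ht h)]; exact isGood_nf _ _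

theorem seqAdd_comm_chain (ht : ∀ x y : M, x ≤ y ∨ y ≤ x) {a b : ℕ → M} (ha : IsGood a)
    (hb : IsGood b) : seqAdd a b = seqAdd b a := by
  by_cases h01 : (one : M) = zero
  · funext i; exact subsingleton_of_eq h01 _ _
  obtain ⟨m, ξ, hξ, rfl⟩ := exists_nf ht h01 ha
  obtain ⟨n, η, hη, rfl⟩ := exists_nf ht h01 hb
  by_cases h : ξ ⊕ₘ η = one
  · rw [seqAdd_nf_carry h, seqAdd_nf_carry (by rwa [oplus_comm]), odot_comm, add_comm m]
  · have h' := disjoint_of_ne_one ht h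
    rw [seqAdd_nf_disjoint h', seqAdd_nf_disjoint (by rwa [odot_comm]), oplus_comm, add_comm m]

theorem seqAdd_assoc_chain (ht : ∀ x y : M, x ≤ y ∨ y ≤ x) {a b c : ℕ → M} (ha : IsGood a)
    (hb : IsGood b) (hc : IsGood c) : seqAdd (seqAdd a b) c = seqAdd a (seqAdd b c) := by
  by_cases h01 : (one : M) = zero
  · funext i; exact subsingleton_of_eq h01 _ _
  obtain ⟨m, ξ, hξ, rfl⟩ := exists_nf ht h01 ha
  obtain ⟨n, η, hη, rfl⟩ := exists_nf ht h01 hb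
  obtain ⟨l, ρ, hρ, rfl⟩ := exists_nf ht h01 hc
  by_cases h1 : ξ ⊕ₘ η = one <;> by_cases h2 : η ⊕ₘ ρ = one
  · -- both inner sums carry
    have e : (ξ ⊙ₘ η) ⊕ₘ ρ = ξ ⊕ₘ (η ⊙ₘ ρ) := by
      have d1 : ∼ₘξ ⊙ₘ ∼ₘη = zero := by rw [← neg_oplus, h1, neg_one]
      have d2 : ∼ₘη ⊙ₘ ∼ₘρ = zero := by rw [← neg_oplus, h2, neg_one]
      have d3 : (∼ₘξ ⊕ₘ ∼ₘη) ⊙ₘ ∼ₘρ = ∼ₘξ ⊙ₘ (∼ₘη ⊕ₘ ∼ₘρ) := by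
        by_cases h3 : ∼ₘξ ⊕ₘ ∼ₘη ⊕ₘ ∼ₘρ = one
        · exact odot_swap₂ d1 d2 h3
        · rw [disjoint_of_ne_one ht h3, disjoint_of_ne_one ht (by rwa [← oplus_assoc])]
      apply neg_inj
      rw [neg_oplus, neg_odot, d3, neg_oplus, neg_odot]
    rw [seqAdd_nf_carry h1, seqAdd_nf_carry h2]
    by_cases h3 : (ξ ⊙ₘ η) ⊕ₘ ρ = one
    · rw [seqAdd_nf_carry h3, seqAdd_nf_carry (e ▸ h3), odot_assoc]
      congr 1; omega
    · rw [seqAdd_nf_disjoint (disjoint_of_ne_one ht h3),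
        seqAdd_nf_disjoint (disjoint_of_ne_one ht (e ▸ h3)), e]
      congr 1; omega
  · have h2' := disjoint_of_ne_one ht h2
    have hr : ρ ⊙ₘ η = zero := by rwa [odot_comm]
    have e := odot_swap₁ hr (show η ⊕ₘ ξ = one by rwa [oplus_comm])
    have h3 : ξ ⊕ₘ (η ⊕ₘ ρ) = one := by rw [← oplus_assoc, h1, one_oplus]
    have h4 : (ξ ⊙ₘ η) ⊙ₘ ρ = zero := by rw [odot_assoc, h2', odot_zero]
    rw [seqAdd_nf_carry h1, seqAdd_nf_disjoint h2', seqAdd_nf_disjoint h4, seqAdd_nf_carry h3]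
    congr 1
    · omega
    · rw [oplus_comm, odot_comm ξ η, ← e, odot_comm, oplus_comm η]
  · have h1' := disjoint_of_ne_one ht h1
    have e := odot_swap₁ h1' h2
    have h3 : (ξ ⊕ₘ η) ⊕ₘ ρ = one := by rw [oplus_assoc, h2, oplus_one]
    have h4 : ξ ⊙ₘ (η ⊙ₘ ρ) = zero := by rw [← odot_assoc, h1', zero_odot]
    rw [seqAdd_nf_carry h2, seqAdd_nf_disjoint h1', seqAdd_nf_disjoint h4, seqAdd_nf_carry h3, e]
    congr 1; omega
  · have h1' := disjoint_of_ne_one ht h1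
    have h2' := disjoint_of_ne_one ht h2
    rw [seqAdd_nf_disjoint h1', seqAdd_nf_disjoint h2']
    by_cases h3 : (ξ ⊕ₘ η) ⊕ₘ ρ = one
    · rw [seqAdd_nf_carry h3, seqAdd_nf_carry (by rwa [← oplus_assoc]), odot_swap₂ h1' h2' h3]
      congr 1; omega
    · rw [seqAdd_nf_disjoint (disjoint_of_ne_one ht h3),
        seqAdd_nf_disjoint (disjoint_of_ne_one ht (by rwa [← oplus_assoc])), oplus_assoc, add_assoc]

theorem seqAdd_cancel_chain (ht : ∀ x y : M, x ≤ y ∨ y ≤ x) {a b c : ℕ → M} (ha : IsGood a)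
    (hb : IsGood b) (hc : IsGood c) (h : seqAdd a c = seqAdd b c) : a = b := by
  by_cases h01 : (one : M) = zero
  · funext i; exact subsingleton_of_eq h01 _ _
  obtain ⟨m, ξ, hξ, rfl⟩ := exists_nf ht h01 ha
  obtain ⟨n, η, hη, rfl⟩ := exists_nf ht h01 hb
  obtain ⟨l, ρ, hρ, rfl⟩ := exists_nf ht h01 hc
  have sub : ∀ {x : M}, x ⊕ₘ ρ = one → x ⊙ₘ ρ ⊕ₘ ∼ₘρ = x := by
    intro x hx
    rw [oplus_comm] at hx
    have := sub_oplus_of_le (oplus_eq_one.1 hx)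
    rwa [neg_neg] at this
  have mixed : ∀ {x y : M}, y ≠ one → y ⊕ₘ ρ = one → x ⊕ₘ ρ = y ⊙ₘ ρ → False := by
    intro x y hy h1 h2
    have : y ⊙ₘ ρ = ρ := le_antisymm (odot_le_right _ _) (h2 ▸ le_oplus_left _ _)
    have h3 := sub h1
    rw [this, oplus_comm, neg_oplus_self] at h3
    exact hy h3.symm
  by_cases h1 : ξ ⊕ₘ ρ = one <;> by_cases h2 : η ⊕ₘ ρ = one
  · rw [seqAdd_nf_carry h1, seqAdd_nf_carry h2] at h
    obtain ⟨e1, e2⟩ := nf_inj (odot_ne_one hξ) (odot_ne_one hη) h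
    rw [← sub h1, ← sub h2, e2, show m = n by omega]
  · rw [seqAdd_nf_carry h1, seqAdd_nf_disjoint (disjoint_of_ne_one ht h2)] at h
    obtain ⟨e1, e2⟩ := nf_inj (odot_ne_one hξ) h2 h
    exact (mixed hξ h1 e2.symm).elim
  · rw [seqAdd_nf_carry h2, seqAdd_nf_disjoint (disjoint_of_ne_one ht h1)] at h
    obtain ⟨e1, e2⟩ := nf_inj h1 (odot_ne_one hη) h
    exact (mixed hη h2 e2).elim
  · have h1' := disjoint_of_ne_one ht h1
    have h2' := disjoint_of_ne_one ht h2
    rw [seqAdd_nf_disjoint h1', seqAdd_nf_disjoint h2'] at h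
    obtain ⟨e1, e2⟩ := nf_inj h1 h2 h
    rw [← oplus_sub_of_disjoint h1', ← oplus_sub_of_disjoint h2', e2, show m = n by omega]

theorem good_total_chain (ht : ∀ x y : M, x ≤ y ∨ y ≤ x) {a b : ℕ → M} (ha : IsGood a)
    (hb : IsGood b) : a ≤ b ∨ b ≤ a := by
  by_cases h01 : (one : M) = zero
  · exact Or.inl fun i => (subsingleton_of_eq h01 _ _).le
  obtain ⟨m, ξ, hξ, rfl⟩ := exists_nf ht h01 ha
  obtain ⟨n, η, hη, rfl⟩ := exists_nf ht h01 hb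
  have key : ∀ {m n : ℕ} {ξ η : M}, m < n → nf m ξ ≤ nf n η := by
    intro m n ξ η h i
    by_cases hi : i < n
    · rw [nf_lt hi]; exact le_one _
    · rw [nf_gt (m := m) (by omega)]; exact zero_le _
  rcases lt_trichotomy m n with h | rfl | h
  · exact Or.inl (key h)
  · refine (ht ξ η).imp ?_ ?_ <;>
    · intro h i
      unfold nf
      split_ifs
      exacts [le_rfl, h, le_rfl]
  · exact Or.inr (key h)

end GoodSequences

end MVAlgebra

namespace MVAlgebra

section GoodSeqMonoid

variable (M : Type u) [MVAlgebra M]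

/-- The set `A_M` of good sequences of `M`. -/
def GoodSeq : Type u := {a : ℕ → M // IsGood a}

variable {M}

theorem seqAdd_good {a b : ℕ → M} (ha : IsGood a) (hb : IsGood b) : IsGood (seqAdd a b) := by
  constructor
  · intro i
    refine eq_of_chains fun C _ f ht => ?_
    rw [f.map_oplus, map_seqAdd, map_seqAdd]
    exact (seqAdd_good_chain ht (ha.map f) (hb.map f)).1 i
  · obtain ⟨m, hm⟩ := ha.2
    obtain ⟨n, hn⟩ := hb.2
    refine ⟨m + n + 1, fun i hi => ?_⟩
    rw [seqAdd, hm i (by omega), hn i (by omega), zero_oplus, oplus_zero, osum_eq_zero]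
    intro k hk
    by_cases hkn : n ≤ k
    · rw [hn k hkn, odot_zero]
    · rw [hm _ (by omega), zero_odot]

theorem seqAdd_comm' {a b : ℕ → M} (ha : IsGood a) (hb : IsGood b) :
    seqAdd a b = seqAdd b a := by
  funext i
  refine eq_of_chains fun C _ f ht => ?_
  rw [map_seqAdd, map_seqAdd, seqAdd_comm_chain ht (ha.map f) (hb.map f)]

theorem seqAdd_assoc' {a b c : ℕ → M} (ha : IsGood a) (hb : IsGood b) (hc : IsGood c) :
    seqAdd (seqAdd a b) c = seqAdd a (seqAdd b c) := by
  funext i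
  refine eq_of_chains fun C _ f ht => ?_
  have := congrFun (seqAdd_assoc_chain ht (ha.map f) (hb.map f) (hc.map f)) i
  simpa only [map_seqAdd] using this

theorem seqAdd_zero (a : ℕ → M) : seqAdd a (fun _ => zero) = a := by
  funext i
  rw [seqAdd, oplus_zero, osum_eq_zero, oplus_zero]
  exact fun k _ => odot_zero _

theorem seqAdd_le_cancel {a b c : ℕ → M} (ha : IsGood a) (hb : IsGood b) (hc : IsGood c)
    (h : seqAdd a c ≤ seqAdd b c) : a ≤ b := by
  intro i
  refine le_of_chains fun C _ f ht => ?_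
  have h' : seqAdd (fun k => f (a k)) (fun k => f (c k)) ≤
      seqAdd (fun k => f (b k)) (fun k => f (c k)) := fun j => by
    rw [← map_seqAdd, ← map_seqAdd]; exact f.map_le (h j)
  rcases good_total_chain ht (ha.map f) (hb.map f) with h1 | h1
  · exact h1 i
  · have := seqAdd_cancel_chain ht (ha.map f) (hb.map f) (hc.map f)
      (le_antisymm h' (fun j => seqAdd_mono h1 j))
    exact (congrFun this i).le

theorem isGood_sup {a b : ℕ → M} (ha : IsGood a) (hb : IsGood b) : IsGood (a ⊔ b) := by
  constructor
  · intro i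
    refine eq_of_chains fun C _ f ht => ?_
    simp only [Pi.sup_apply, f.map_oplus, f.map_sup]
    rcases good_total_chain ht (ha.map f) (hb.map f) with h | h
    · rw [sup_eq_right.2 (h i), sup_eq_right.2 (h (i + 1))]; exact (hb.map f).1 i
    · rw [sup_eq_left.2 (h i), sup_eq_left.2 (h (i + 1))]; exact (ha.map f).1 i
  · obtain ⟨m, hm⟩ := ha.2
    obtain ⟨n, hn⟩ := hb.2
    exact ⟨m + n, fun i hi => by
      rw [Pi.sup_apply, hm i (by omega), hn i (by omega), sup_idem]⟩

theorem isGood_inf {a b : ℕ → M} (ha : IsGood a) (hb : IsGood b) : IsGood (a ⊓ b) := by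
  constructor
  · intro i
    refine eq_of_chains fun C _ f ht => ?_
    simp only [Pi.inf_apply, f.map_oplus, f.map_inf]
    rcases good_total_chain ht (ha.map f) (hb.map f) with h | h
    · rw [inf_eq_left.2 (h i), inf_eq_left.2 (h (i + 1))]; exact (ha.map f).1 i
    · rw [inf_eq_right.2 (h i), inf_eq_right.2 (h (i + 1))]; exact (hb.map f).1 i
  · obtain ⟨m, hm⟩ := ha.2
    obtain ⟨n, hn⟩ := hb.2
    exact ⟨m + n, fun i hi => by
      rw [Pi.inf_apply, hm i (by omega), hn i (by omega), inf_idem]⟩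

theorem seqAdd_sup {a b c : ℕ → M} (ha : IsGood a) (hb : IsGood b) :
    seqAdd (a ⊔ b) c = seqAdd a c ⊔ seqAdd b c := by
  funext i
  refine eq_of_chains fun C _ f ht => ?_
  simp only [Pi.sup_apply, f.map_sup, map_seqAdd]
  rcases good_total_chain ht (ha.map f) (hb.map f) with h | h
  · rw [sup_eq_right.2 (seqAdd_mono h i)]
    congr 1; funext k; exact sup_eq_right.2 (h k)
  · rw [sup_eq_left.2 (seqAdd_mono h i)]
    congr 1; funext k; exact sup_eq_left.2 (h k)

theorem seqAdd_inf {a b c : ℕ → M} (ha : IsGood a) (hb : IsGood b) :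
    seqAdd (a ⊓ b) c = seqAdd a c ⊓ seqAdd b c := by
  funext i
  refine eq_of_chains fun C _ f ht => ?_
  simp only [Pi.inf_apply, f.map_inf, map_seqAdd]
  rcases good_total_chain ht (ha.map f) (hb.map f) with h | h
  · rw [inf_eq_left.2 (seqAdd_mono h i)]
    congr 1; funext k; exact inf_eq_left.2 (h k)
  · rw [inf_eq_right.2 (seqAdd_mono h i)]
    congr 1; funext k; exact inf_eq_right.2 (h k)

namespace GoodSeq

/-- Good sequences carry the componentwise order of `M^ℕ`. -/
instance : Lattice (GoodSeq M) :=
  Subtype.lattice (fun _ _ ha hb => isGood_sup ha hb) (fun _ _ ha hb => isGood_inf ha hb)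

instance : Zero (GoodSeq M) := ⟨⟨fun _ => zero, fun _ => oplus_zero _, 0, fun _ _ => rfl⟩⟩

instance : Add (GoodSeq M) := ⟨fun a b => ⟨seqAdd a.1 b.1, seqAdd_good a.2 b.2⟩⟩

/-- The monoid `A_M` of good sequences. -/
instance : AddCommMonoid (GoodSeq M) where
  add_assoc a b c := Subtype.ext (seqAdd_assoc' a.2 b.2 c.2)
  add_comm a b := Subtype.ext (seqAdd_comm' a.2 b.2)
  add_zero a := Subtype.ext (seqAdd_zero a.1)
  zero_add a := Subtype.ext ((seqAdd_comm'
    ⟨fun _ => oplus_zero _, 0, fun _ _ => rfl⟩ a.2).trans (seqAdd_zero a.1))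
  nsmul := nsmulRec

theorem add_val (a b : GoodSeq M) : (a + b).1 = seqAdd a.1 b.1 := rfl

theorem zero_val : (0 : GoodSeq M).1 = fun _ => zero := rfl

theorem le_iff {a b : GoodSeq M} : a ≤ b ↔ a.1 ≤ b.1 := Iff.rfl

instance : IsOrderedCancelAddMonoid (GoodSeq M) where
  add_le_add_left a b h c := fun i => seqAdd_mono (c := c.1) h i
  le_of_add_le_add_left a b c h := by
    rw [add_comm a b, add_comm a c] at h
    exact seqAdd_le_cancel b.2 c.2 a.2 h

theorem sup_add (a b c : GoodSeq M) : (a ⊔ b) + c = (a + c) ⊔ (b + c) :=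
  Subtype.ext (seqAdd_sup a.2 b.2)

theorem inf_add (a b c : GoodSeq M) : (a ⊓ b) + c = (a + c) ⊓ (b + c) :=
  Subtype.ext (seqAdd_inf a.2 b.2)

/-- The good sequence `(a) = (a, 0, 0, …)`. -/
def single (a : M) : GoodSeq M := ⟨fun i => if i = 0 then a else zero, by
  refine ⟨fun i => ?_, 1, fun i hi => if_neg (by omega)⟩
  simp only [if_neg (Nat.succ_ne_zero i), oplus_zero]⟩

/-- The map `h* : A_M → A_N` applying a homomorphism `h` componentwise. -/
def map {N : Type v} [MVAlgebra N] (h : MVHom M N) : GoodSeq M →+ GoodSeq N where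
  toFun a := ⟨fun i => h (a.1 i), a.2.map h⟩
  map_zero' := Subtype.ext (funext fun _ => h.map_zero)
  map_add' a b := Subtype.ext (funext fun i => map_seqAdd h a.1 b.1 i)

end GoodSeq

end GoodSeqMonoid

end MVAlgebra

/-- Unital Abelian `ℓ`-groups: Abelian groups with a translation-invariant lattice order and a
distinguished strong order unit. -/
class UnitalLGroup (G : Type u) extends AddCommGroup G, Lattice G, IsOrderedAddMonoid G where
  unit : G
  unit_nonneg : 0 ≤ unit
  exists_le_nsmul_unit : ∀ g : G, ∃ n : ℕ, g ≤ n • unit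

section Constructions

open MVAlgebra

/-- The enveloping group `Ξ M`: the Grothendieck group of the monoid of good sequences of `M`. -/
def Xi (M : Type u) [MVAlgebra M] : Type u := Algebra.GrothendieckAddGroup (GoodSeq M)

namespace Xi

variable {M : Type u} [MVAlgebra M]

instance : AddCommGroup (Xi M) := inferInstanceAs (AddCommGroup (Algebra.GrothendieckAddGroup _))

/-- The class `[a, b]` of a pair of good sequences. -/
def mk (a b : GoodSeq M) : Xi M := AddLocalization.mk a ⟨b, AddSubmonoid.mem_top b⟩

/-- The order of `Ξ M`; by `Xi.mk_le_mk`, `[a, b] ≤ [c, d]` when `d + a ≤ b + c` in `A_M`. -/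
instance : PartialOrder (Xi M) := inferInstanceAs
  (PartialOrder (AddLocalization (⊤ : AddSubmonoid (GoodSeq M))))

theorem mk_le_mk {a b c d : GoodSeq M} : mk a b ≤ mk c d ↔ d + a ≤ b + c := Iff.rfl

theorem mk_eq_mk {a b c d : GoodSeq M} : mk a b = mk c d ↔ a + d = c + b := by
  rw [le_antisymm_iff, mk_le_mk, mk_le_mk, add_comm d, add_comm b, ← le_antisymm_iff]

theorem mk_add_mk (a b c d : GoodSeq M) : mk a b + mk c d = mk (a + c) (b + d) :=
  AddLocalization.mk_add _ _ _ _

theorem zero_def : (0 : Xi M) = mk 0 0 := AddLocalization.mk_zero.symm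

theorem neg_mk (a b : GoodSeq M) : -mk a b = mk b a := rfl

theorem ind {p : Xi M → Prop} (h : ∀ a b, p (mk a b)) (x : Xi M) : p x :=
  AddLocalization.induction_on x fun y => h y.1 y.2.1

theorem exists_common (x y : Xi M) : ∃ a b s, x = mk a s ∧ y = mk b s := by
  induction x using Xi.ind with | h a s
  induction y using Xi.ind with | h b t
  refine ⟨a + t, b + s, s + t, mk_eq_mk.2 ?_, mk_eq_mk.2 ?_⟩ <;> abel

theorem isLUB_mk (a b s : GoodSeq M) : IsLUB {mk a s, mk b s} (mk (a ⊔ b) s) := by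
  constructor
  · rintro x (rfl | rfl)
    · exact mk_le_mk.2 (add_le_add_right le_sup_left s)
    · exact mk_le_mk.2 (add_le_add_right le_sup_right s)
  · intro x hx
    induction x using Xi.ind with | h c t
    have h1 := mk_le_mk.1 (hx (Set.mem_insert _ _))
    have h2 := mk_le_mk.1 (hx (Set.mem_insert_of_mem _ rfl))
    rw [mk_le_mk, add_comm, GoodSeq.sup_add, add_comm a, add_comm b]
    exact sup_le h1 h2

theorem isGLB_mk (a b s : GoodSeq M) : IsGLB {mk a s, mk b s} (mk (a ⊓ b) s) := by
  constructor
  · rintro x (rfl | rfl)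
    · exact mk_le_mk.2 (add_le_add_right inf_le_left s)
    · exact mk_le_mk.2 (add_le_add_right inf_le_right s)
  · intro x hx
    induction x using Xi.ind with | h c t
    have h1 := mk_le_mk.1 (hx (Set.mem_insert _ _))
    have h2 := mk_le_mk.1 (hx (Set.mem_insert_of_mem _ rfl))
    rw [mk_le_mk, add_comm t, GoodSeq.inf_add, add_comm a, add_comm b]
    exact le_inf h1 h2

theorem exists_isLUB (x y : Xi M) : ∃ z, IsLUB {x, y} z := by
  obtain ⟨a, b, s, rfl, rfl⟩ := exists_common x y
  exact ⟨_, isLUB_mk a b s⟩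

theorem exists_isGLB (x y : Xi M) : ∃ z, IsGLB {x, y} z := by
  obtain ⟨a, b, s, rfl, rfl⟩ := exists_common x y
  exact ⟨_, isGLB_mk a b s⟩

noncomputable instance : Lattice (Xi M) where
  sup x y := (exists_isLUB x y).choose
  inf x y := (exists_isGLB x y).choose
  le_sup_left x y := (exists_isLUB x y).choose_spec.1 (Set.mem_insert _ _)
  le_sup_right x y := (exists_isLUB x y).choose_spec.1 (Set.mem_insert_of_mem _ rfl)
  sup_le x y z h1 h2 := (exists_isLUB x y).choose_spec.2 (by rintro w (rfl | rfl) <;> assumption)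
  inf_le_left x y := (exists_isGLB x y).choose_spec.1 (Set.mem_insert _ _)
  inf_le_right x y := (exists_isGLB x y).choose_spec.1 (Set.mem_insert_of_mem _ rfl)
  le_inf x y z h1 h2 := (exists_isGLB y z).choose_spec.2 (by rintro w (rfl | rfl) <;> assumption)

theorem mk_sup_mk (a b s : GoodSeq M) : mk a s ⊔ mk b s = mk (a ⊔ b) s :=
  isLUB_pair.unique (isLUB_mk a b s)

theorem mk_inf_mk (a b s : GoodSeq M) : mk a s ⊓ mk b s = mk (a ⊓ b) s :=
  isGLB_pair.unique (isGLB_mk a b s)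

theorem exists_good_le (a : GoodSeq M) : ∃ n : ℕ, a ≤ n • GoodSeq.single (one : M) := by
  have hn : ∀ n : ℕ, (n • GoodSeq.single (one : M)).1 = nf n zero := by
    intro n
    induction n with
    | zero =>
      rw [zero_nsmul, GoodSeq.zero_val]; funext i; simp [nf]
    | succ n ih =>
      rw [succ_nsmul, GoodSeq.add_val, ih]
      have : (GoodSeq.single (one : M)).1 = nf 0 one := by
        funext i; simp [GoodSeq.single, nf]
      rw [this, seqAdd_nf_carry (zero_oplus _), zero_odot, add_zero]
  obtain ⟨n, h⟩ := a.2.2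
  refine ⟨n, fun i => ?_⟩
  rw [hn]
  by_cases hi : i < n
  · rw [nf_lt hi]; exact le_one _
  · rw [h i (by omega)]; exact zero_le _

theorem nsmul_mk (n : ℕ) (a : GoodSeq M) : n • mk a 0 = mk (n • a) 0 := by
  induction n with
  | zero => rw [zero_nsmul, zero_nsmul, zero_def]
  | succ n ih => rw [succ_nsmul, succ_nsmul, ih, mk_add_mk, add_zero]

/-- `Ξ M` is a unital Abelian `ℓ`-group, with unit `[(1), (0)]`. -/
noncomputable instance : UnitalLGroup (Xi M) where
  add_le_add_left x y h z := by
    induction x using Xi.ind with | h a s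
    induction y using Xi.ind with | h b t
    induction z using Xi.ind with | h c r
    rw [mk_le_mk] at h
    rw [mk_add_mk, mk_add_mk, mk_le_mk, add_add_add_comm, add_add_add_comm s]
    exact add_le_add_left h _
  unit := mk (GoodSeq.single one) 0
  unit_nonneg := by
    rw [zero_def, mk_le_mk]
    exact add_le_add_right (fun i => zero_le _) _
  exists_le_nsmul_unit x := by
    induction x using Xi.ind with | h a s
    obtain ⟨n, hn⟩ := exists_good_le a
    refine ⟨n, ?_⟩
    rw [nsmul_mk, mk_le_mk, zero_add]
    refine hn.trans ?_
    have h0 : (0 : GoodSeq M) ≤ s := fun i => zero_le _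
    exact le_add_of_nonneg_left h0

end Xi

/-! ### The unit interval -/

/-- The unit interval `Γ G = {a ∈ G | 0 ≤ a ≤ 1}` of a unital Abelian `ℓ`-group. -/
@[ext]
structure Gamma (G : Type u) [UnitalLGroup G] : Type u where
  val : G
  nonneg : 0 ≤ val
  le_unit : val ≤ UnitalLGroup.unit

namespace Gamma

variable {G : Type u} [UnitalLGroup G]

local notation "𝟏" => UnitalLGroup.unit

/-- `Γ G` is an MV-algebra with `a ⊕ b = (a + b) ∧ 1` and `¬a = 1 - a`. -/
instance : MVAlgebra (Gamma G) where
  oplus a b := ⟨(a.val + b.val) ⊓ 𝟏, le_inf (add_nonneg a.nonneg b.nonneg) UnitalLGroup.unit_nonneg,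
    inf_le_right⟩
  neg a := ⟨𝟏 - a.val, sub_nonneg.2 a.le_unit, sub_le_self _ a.nonneg⟩
  zero := ⟨0, le_rfl, UnitalLGroup.unit_nonneg⟩
  oplus_assoc a b c := by
    apply Gamma.ext
    have h1 : (𝟏 : G) ≤ 𝟏 + c.val := le_add_of_nonneg_right c.nonneg
    have h2 : (𝟏 : G) ≤ a.val + 𝟏 := le_add_of_nonneg_left a.nonneg
    change ((a.val + b.val) ⊓ 𝟏 + c.val) ⊓ 𝟏 = (a.val + (b.val + c.val) ⊓ 𝟏) ⊓ 𝟏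
    rw [inf_add, add_inf, inf_assoc, inf_assoc, inf_eq_right.2 h1, inf_eq_right.2 h2, add_assoc]
  oplus_comm a b := Gamma.ext (by simp only [add_comm])
  oplus_zero a := Gamma.ext (by simp only [add_zero]; exact inf_eq_left.2 a.le_unit)
  neg_neg a := Gamma.ext (by simp only [sub_sub_cancel])
  oplus_neg_zero a := Gamma.ext (by
    simp only [sub_zero]; exact inf_eq_right.2 (le_add_of_nonneg_left a.nonneg))
  neg_oplus_oplus := by
    have key : ∀ x y : G, 𝟏 - (𝟏 - x + y) ⊓ 𝟏 + y = x ⊔ y := fun x y => by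
      rw [sub_eq_add_neg, neg_inf, add_sup, sup_add]; congr 1 <;> abel
    intro x y
    apply Gamma.ext
    change (𝟏 - (𝟏 - x.val + y.val) ⊓ 𝟏 + y.val) ⊓ 𝟏 = (𝟏 - (𝟏 - y.val + x.val) ⊓ 𝟏 + x.val) ⊓ 𝟏
    rw [key, key, sup_comm]

theorem oplus_val (a b : Gamma G) : (a ⊕ₘ b).val = (a.val + b.val) ⊓ 𝟏 := rfl

theorem neg_val (a : Gamma G) : (∼ₘa).val = 𝟏 - a.val := rfl

theorem zero_val : (MVAlgebra.zero : Gamma G).val = 0 := rfl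

theorem one_val : (MVAlgebra.one : Gamma G).val = 𝟏 := sub_zero _

theorem odot_eq_zero_iff (a b : Gamma G) : a ⊙ₘ b = MVAlgebra.zero ↔ a.val + b.val ≤ 𝟏 := by
  have h : (∼ₘa ⊕ₘ ∼ₘb = MVAlgebra.one) ↔ a.val + b.val ≤ 𝟏 := by
    rw [← le_sub_iff_add_le, ← sub_nonneg (a := 𝟏 - b.val)]
    constructor
    · intro h
      have h' := congrArg Gamma.val h
      rw [oplus_val, neg_val, neg_val, one_val, inf_eq_right] at h'
      have : (𝟏 : G) - b.val - a.val = (𝟏 - a.val + (𝟏 - b.val)) - 𝟏 := by abel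
      rw [this]; exact sub_nonneg.2 h'
    · intro h
      apply Gamma.ext
      rw [oplus_val, neg_val, neg_val, one_val, inf_eq_right, ← sub_nonneg]
      have : (𝟏 : G) - b.val - a.val = (𝟏 - a.val + (𝟏 - b.val)) - 𝟏 := by abel
      rwa [← this]
  rw [← h, odot_eq_zero, le_def]

theorem oplus_val_of_odot {a b : Gamma G} (h : a ⊙ₘ b = MVAlgebra.zero) :
    (a ⊕ₘ b).val = a.val + b.val :=
  inf_eq_left.2 ((odot_eq_zero_iff a b).1 h)

end Gamma

/-! ### Morphisms -/

namespace Xi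

variable {M : Type u} [MVAlgebra M]

/-- The map `M → Ξ M`, `a ↦ [(a), (0)]`. -/
def of (a : M) : Xi M := mk (GoodSeq.single a) (GoodSeq.single MVAlgebra.zero)

theorem single_zero : GoodSeq.single (MVAlgebra.zero : M) = 0 :=
  Subtype.ext (funext fun i => by
    change (if i = 0 then _ else _) = MVAlgebra.zero
    exact ite_self _)

theorem of_def (a : M) : of a = mk (GoodSeq.single a) 0 := by rw [of, single_zero]

theorem of_one : of (MVAlgebra.one : M) = UnitalLGroup.unit := of_def _

theorem of_le_of {a b : M} (h : a ≤ b) : of a ≤ of b := by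
  rw [of_def, of_def, mk_le_mk]
  refine add_le_add_right (fun i => ?_) _
  by_cases hi : i = 0
  · subst hi; exact h
  · change (if i = 0 then _ else _) ≤ (if i = 0 then _ else _)
    rw [if_neg hi, if_neg hi]

theorem of_zero : of (MVAlgebra.zero : M) = 0 := by rw [of_def, single_zero, zero_def]

theorem of_add_of_eq_iff {x y z : M} :
    of z = of x + of y ↔ x ⊙ₘ y = MVAlgebra.zero ∧ z = x ⊕ₘ y := by
  have hs : ∀ w : M, (GoodSeq.single w).1 = nf 0 w := fun w => by
    funext i; simp [GoodSeq.single, nf]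
  rw [of_def, of_def, of_def, mk_add_mk, mk_eq_mk, add_zero, add_zero, add_zero]
  constructor
  · intro h
    have h' := congrArg Subtype.val h
    rw [GoodSeq.add_val, hs, hs, hs] at h'
    have h0 := congrFun h' 0
    have h1 := congrFun h' 1
    rw [nf_self, seqAdd_nf_eq 0 0] at h0
    rw [nf_gt Nat.zero_lt_one, seqAdd_nf_succ 0 0] at h1
    exact ⟨h1.symm, h0⟩
  · rintro ⟨h1, rfl⟩
    apply Subtype.ext
    rw [GoodSeq.add_val, hs, hs, hs, seqAdd_nf_disjoint h1]

end Xi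

/-- States between MV-algebras: `s 1 = 1`, and `s (a ⊕ b) = s a + s b` in `Ξ N` if `a ⊙ b = 0`. -/
@[ext]
structure MVState (M : Type u) (N : Type v) [MVAlgebra M] [MVAlgebra N] where
  toFun : M → N
  map_one : toFun MVAlgebra.one = MVAlgebra.one
  map_oplus : ∀ a b : M, a ⊙ₘ b = MVAlgebra.zero →
    Xi.of (toFun (a ⊕ₘ b)) = Xi.of (toFun a) + Xi.of (toFun b)

/-- Homomorphisms of unital Abelian `ℓ`-groups. -/
@[ext]
structure UnitalLHom (G : Type u) (H : Type v) [UnitalLGroup G] [UnitalLGroup H] where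
  toFun : G → H
  map_add : ∀ a b, toFun (a + b) = toFun a + toFun b
  map_sup : ∀ a b, toFun (a ⊔ b) = toFun a ⊔ toFun b
  map_inf : ∀ a b, toFun (a ⊓ b) = toFun a ⊓ toFun b
  map_unit : toFun UnitalLGroup.unit = UnitalLGroup.unit

/-- States between unital Abelian `ℓ`-groups: normalised positive group homomorphisms. -/
@[ext]
structure LState (G : Type u) (H : Type v) [UnitalLGroup G] [UnitalLGroup H] where
  toFun : G → H
  map_add : ∀ a b, toFun (a + b) = toFun a + toFun b
  map_nonneg : ∀ a, 0 ≤ a → 0 ≤ toFun a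
  map_unit : toFun UnitalLGroup.unit = UnitalLGroup.unit

namespace MVState

variable {M : Type u} {N : Type v} [MVAlgebra M] [MVAlgebra N]

instance : CoeFun (MVState M N) (fun _ => M → N) := ⟨MVState.toFun⟩

/-- Homomorphisms of MV-algebras are states. -/
def ofHom (h : MVHom M N) : MVState M N where
  toFun := h
  map_one := h.map_one
  map_oplus a b hab := Xi.of_add_of_eq_iff.2
    ⟨by rw [← h.map_odot, hab, h.map_zero], h.map_oplus a b⟩

end MVState

namespace UnitalLHom

variable {G : Type u} {H : Type v} [UnitalLGroup G] [UnitalLGroup H]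

instance : CoeFun (UnitalLHom G H) (fun _ => G → H) := ⟨UnitalLHom.toFun⟩

theorem map_zero (f : UnitalLHom G H) : f 0 = 0 := by
  have := f.map_add 0 0
  rwa [add_zero, left_eq_add] at this

theorem map_sub (f : UnitalLHom G H) (a b : G) : f (a - b) = f a - f b := by
  rw [eq_sub_iff_add_eq, ← f.map_add, sub_add_cancel]

theorem map_le (f : UnitalLHom G H) {a b : G} (h : a ≤ b) : f a ≤ f b := by
  rw [← sup_eq_right, ← f.map_sup, sup_eq_right.2 h]

end UnitalLHom

namespace LState

variable {G : Type u} {H : Type v} [UnitalLGroup G] [UnitalLGroup H]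

instance : CoeFun (LState G H) (fun _ => G → H) := ⟨LState.toFun⟩

theorem map_zero (f : LState G H) : f 0 = 0 := by
  have := f.map_add 0 0
  rwa [add_zero, left_eq_add] at this

theorem map_sub (f : LState G H) (a b : G) : f (a - b) = f a - f b := by
  rw [eq_sub_iff_add_eq, ← f.map_add, sub_add_cancel]

theorem map_le (f : LState G H) {a b : G} (h : a ≤ b) : f a ≤ f b := by
  rw [← sub_nonneg, ← f.map_sub]; exact f.map_nonneg _ (sub_nonneg.2 h)

/-- Homomorphisms of unital Abelian `ℓ`-groups are states. -/
def ofHom (h : UnitalLHom G H) : LState G H where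
  toFun := h
  map_add := h.map_add
  map_nonneg a ha := by rw [← h.map_zero]; exact h.map_le ha
  map_unit := h.map_unit

end LState

namespace Gamma

variable {G : Type u} {H : Type v} [UnitalLGroup G] [UnitalLGroup H]

/-- The restriction of a homomorphism to the unit intervals. -/
def mapHom (f : UnitalLHom G H) : MVHom (Gamma G) (Gamma H) where
  toFun a := ⟨f a.val, by rw [← f.map_zero]; exact f.map_le a.nonneg,
    by rw [← f.map_unit]; exact f.map_le a.le_unit⟩
  map_oplus a b := Gamma.ext (by
    simp only [oplus_val, f.map_inf, f.map_add, f.map_unit])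
  map_neg a := Gamma.ext (by simp only [neg_val, f.map_sub, f.map_unit])
  map_zero := Gamma.ext f.map_zero

/-- The restriction of a state to the unit intervals. -/
def mapState (s : LState G H) : MVState (Gamma G) (Gamma H) where
  toFun a := ⟨s a.val, s.map_nonneg _ a.nonneg, by rw [← s.map_unit]; exact s.map_le a.le_unit⟩
  map_one := Gamma.ext (by simp only [one_val]; exact s.map_unit)
  map_oplus a b hab := by
    rw [Xi.of_add_of_eq_iff, odot_eq_zero_iff]
    have h1 : s a.val + s b.val ≤ UnitalLGroup.unit := by
      rw [← s.map_add, ← s.map_unit]; exact s.map_le ((odot_eq_zero_iff a b).1 hab)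
    refine ⟨h1, Gamma.ext ?_⟩
    simp only [oplus_val_of_odot hab]
    rw [oplus_val, inf_eq_left.2 h1, s.map_add]

end Gamma

namespace Xi

variable {M : Type u} {N : Type v} [MVAlgebra M] [MVAlgebra N]

/-- The map `φ_M : M → Γ Ξ M`, `a ↦ [(a), (0)]`. -/
def phi (a : M) : Gamma (Xi M) :=
  ⟨of a, by rw [← of_zero]; exact of_le_of (zero_le a), by rw [← of_one]; exact of_le_of (le_one a)⟩

/-- The map `Ξ h : Ξ M → Ξ N`, `[a, b] ↦ [h* a, h* b]`, for a homomorphism `h`. -/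
noncomputable def mapFun (h : MVHom M N) : Xi M →+ Xi N :=
  Algebra.GrothendieckAddGroup.lift
    ((Algebra.GrothendieckAddGroup.of (M := GoodSeq N)).comp (GoodSeq.map h))

theorem mapFun_mk (h : MVHom M N) (a b : GoodSeq M) :
    mapFun h (mk a b) = mk (GoodSeq.map h a) (GoodSeq.map h b) := by
  have h0 : ∀ c : GoodSeq M, mapFun h (mk c 0) = mk (GoodSeq.map h c) 0 := fun c => by
    exact AddSubmonoid.LocalizationMap.lift_eq _ _ c
  have h1 : mk a b = mk a 0 - mk b 0 := by
    rw [sub_eq_add_neg, neg_mk, mk_add_mk, add_zero, zero_add]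
  rw [h1, _root_.map_sub, h0, h0, sub_eq_add_neg, neg_mk, mk_add_mk, add_zero, zero_add]

/-- The unital `ℓ`-homomorphism `Ξ h`. -/
noncomputable def mapHom (h : MVHom M N) : UnitalLHom (Xi M) (Xi N) where
  toFun := mapFun h
  map_add := (mapFun h).map_add
  map_sup x y := by
    obtain ⟨a, b, s, rfl, rfl⟩ := exists_common x y
    rw [mk_sup_mk, mapFun_mk, mapFun_mk, mapFun_mk, mk_sup_mk]
    congr 1
    exact Subtype.ext (funext fun i => h.map_sup _ _)
  map_inf x y := by
    obtain ⟨a, b, s, rfl, rfl⟩ := exists_common x y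
    rw [mk_inf_mk, mapFun_mk, mapFun_mk, mapFun_mk, mk_inf_mk]
    congr 1
    exact Subtype.ext (funext fun i => h.map_inf _ _)
  map_unit := by
    change mapFun h (mk _ _) = mk _ _
    rw [mapFun_mk, _root_.map_zero]
    congr 1
    exact Subtype.ext (funext fun i => by
      change h (if i = 0 then _ else _) = if i = 0 then _ else _
      split_ifs
      · exact h.map_one
      · exact h.map_zero)

end Xi

/-! ### The four categories -/

/-- The category `MV` of MV-algebras and their homomorphisms. -/
structure MVCat : Type (u + 1) where
  carrier : Type u
  [str : MVAlgebra carrier]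

/-- The category of MV-algebras and states. -/
structure MVStateCat : Type (u + 1) where
  carrier : Type u
  [str : MVAlgebra carrier]

/-- The category of unital Abelian `ℓ`-groups and unital `ℓ`-homomorphisms. -/
structure LGroupCat : Type (u + 1) where
  carrier : Type u
  [str : UnitalLGroup carrier]

/-- The category of unital Abelian `ℓ`-groups and states. -/
structure LGroupStateCat : Type (u + 1) where
  carrier : Type u
  [str : UnitalLGroup carrier]

attribute [instance] MVCat.str MVStateCat.str LGroupCat.str LGroupStateCat.str

instance : Category MVCat.{u} where
  Hom M N := MVHom M.carrier N.carrier
  id M := ⟨fun a => a, fun _ _ => rfl, fun _ => rfl, rfl⟩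
  comp f g := ⟨fun a => g.toFun (f.toFun a), fun a b => by rw [f.map_oplus, g.map_oplus],
    fun a => by rw [f.map_neg, g.map_neg], by rw [f.map_zero, g.map_zero]⟩

instance : Category MVStateCat.{u} where
  Hom M N := MVState M.carrier N.carrier
  id M := ⟨fun a => a, rfl, fun _ _ h => Xi.of_add_of_eq_iff.2 ⟨h, rfl⟩⟩
  comp f g := ⟨fun a => g.toFun (f.toFun a), by rw [f.map_one, g.map_one], fun a b h => by
    obtain ⟨h1, h2⟩ := Xi.of_add_of_eq_iff.1 (f.map_oplus a b h)
    rw [h2]; exact g.map_oplus _ _ h1⟩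

instance : Category LGroupCat.{u} where
  Hom G H := UnitalLHom G.carrier H.carrier
  id G := ⟨fun a => a, fun _ _ => rfl, fun _ _ => rfl, fun _ _ => rfl, rfl⟩
  comp f g := ⟨fun a => g.toFun (f.toFun a), fun a b => by rw [f.map_add, g.map_add],
    fun a b => by rw [f.map_sup, g.map_sup], fun a b => by rw [f.map_inf, g.map_inf],
    by rw [f.map_unit, g.map_unit]⟩

instance : Category LGroupStateCat.{u} where
  Hom G H := LState G.carrier H.carrier
  id G := ⟨fun a => a, fun _ _ => rfl, fun _ h => h, rfl⟩
  comp f g := ⟨fun a => g.toFun (f.toFun a), fun a b => by rw [f.map_add, g.map_add],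
    fun a h => g.map_nonneg _ (f.map_nonneg a h), by rw [f.map_unit, g.map_unit]⟩

/-- The inclusion of homomorphisms into states, for MV-algebras. -/
def MVCat.incl : MVCat.{u} ⥤ MVStateCat.{u} where
  obj M := ⟨M.carrier⟩
  map f := MVState.ofHom f

/-- The inclusion of homomorphisms into states, for unital Abelian `ℓ`-groups. -/
def LGroupCat.incl : LGroupCat.{u} ⥤ LGroupStateCat.{u} where
  obj G := ⟨G.carrier⟩
  map f := LState.ofHom f

/-! ### The functors -/

/-- Mundici's functor `Γ` on homomorphisms. -/
def GammaHom : LGroupCat.{u} ⥤ MVCat.{u} where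
  obj G := ⟨Gamma G.carrier⟩
  map f := Gamma.mapHom f

/-- The functor `Γ` on states. -/
def GammaState : LGroupStateCat.{u} ⥤ MVStateCat.{u} where
  obj G := ⟨Gamma G.carrier⟩
  map s := Gamma.mapState s

/-- Mundici's functor `Ξ` on homomorphisms. -/
noncomputable def XiHom : MVCat.{u} ⥤ LGroupCat.{u} where
  obj M := ⟨Xi M.carrier⟩
  map h := Xi.mapHom h
  map_id M := UnitalLHom.ext (funext fun x => by
    induction x using Xi.ind with | h a b
    exact Xi.mapFun_mk _ a b)
  map_comp f g := UnitalLHom.ext (funext fun x => by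
    induction x using Xi.ind with | h a b
    refine (Xi.mapFun_mk _ a b).trans ?_
    change _ = Xi.mapFun g (Xi.mapFun f (Xi.mk a b))
    rw [Xi.mapFun_mk, Xi.mapFun_mk]; rfl)

/-- Every state `s : M → N` of MV-algebras has exactly one extension to a state `Ξ M → Ξ N`. -/
def UniqueStateExtension : Prop :=
  ∀ (M N : Type u) [MVAlgebra M] [MVAlgebra N] (s : MVState M N),
    ∃! t : LState (Xi M) (Xi N), ∀ a : M, t (Xi.of a) = Xi.of (s a)

/-- The functor `Ξ` on states, sending `s` to its unique extension. -/
noncomputable def XiState (h : UniqueStateExtension.{u}) : MVStateCat.{u} ⥤ LGroupStateCat.{u} where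
  obj M := ⟨Xi M.carrier⟩
  map {M N} s := (h M.carrier N.carrier s).choose
  map_id M := by
    symm
    exact (h M.carrier M.carrier (𝟙 M)).choose_spec.2 _ fun a => rfl
  map_comp {M N P} s t := by
    symm
    refine (h M.carrier P.carrier (s ≫ t)).choose_spec.2 _ fun a => ?_
    have h1 := (h M.carrier N.carrier s).choose_spec.1 a
    have h2 := (h N.carrier P.carrier t).choose_spec.1 (s.toFun a)
    exact (congrArg _ h1).trans h2

end Constructions

/-! Let `s` be additive on disjoint sums, with values in an Abelian group. Then `s (x ⊕ y) + s (x ⊙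
y) = s x + s y` for all `x`, `y` (`disjoint_additive_oplus`), because `x ⊕ y` and `y` both split
disjointly over `y ∧ ¬x`. Adding `(b)` to a good sequence replaces each entry by a truncated sum and
passes the carry `aᵢ ⊙ b` to the next one. The valuation identity makes the carries telescope, so `∑
s (aᵢ)` is additive on good sequences (`GoodSeq.sum_add`). Passing to differences extends `s` to `Ξ
M`. Positivity follows because `b ≤ a` in `A_M` means that `a = c + b` for some good sequence `c`
(`GoodSeq.exists_add_of_le`). Uniqueness follows because the sequences `(a)` generate `A_M`
(`Xi.state_ext`).

The same construction, applied to the inclusion of `Γ G` in `G`, gives a state `Ξ Γ G → G`. It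
reflects the order: a good sequence with image `g` has first entry `g ∧ 1`, and the remaining
entries form a good sequence with image `(g - 1) ∨ 0`, so all its entries are monotone functions of
`g`. It is onto because the strong unit lets every `g ≥ 0` be exhausted by repeatedly removing `g ∧
1`. Hence its inverse is again a state. On the other side, an element of `Ξ M` between `0` and `1`
comes from a good sequence below `(1)`, hence from an element of `M`. Naturality, the triangle
identity and the agreement of `Ξ` with Mundici's functor are equalities of states that can be tested
on `M`. -/

namespace MVAlgebra

/-! ### Disjoint decompositions and the valuation identity. -/

section Valuations

variable {M : Type u} [MVAlgebra M]

theorem odot_inf_neg (x y : M) : x ⊙ₘ (y ⊓ ∼ₘx) = zero := by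
  rw [odot_comm, odot_eq_zero]; exact inf_le_right

theorem oplus_inf_neg (x y : M) : x ⊕ₘ (y ⊓ ∼ₘx) = x ⊕ₘ y := by
  rw [inf_eq, neg_neg, odot_comm, oplus_comm x y, oplus_comm x]
  exact sub_oplus_of_le (le_oplus_left y x)

theorem inf_neg_odot (x y : M) : (y ⊓ ∼ₘx) ⊙ₘ (x ⊙ₘ y) = zero := by
  rw [← odot_assoc, odot_comm (y ⊓ ∼ₘx), odot_inf_neg, zero_odot]

/-- Here `y ∧ ¬x` is the difference `y ⊙ ¬(x ⊙ y)`, and adding back `x ⊙ y ≤ y` restores `y`. -/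
theorem inf_neg_oplus (x y : M) : (y ⊓ ∼ₘx) ⊕ₘ (x ⊙ₘ y) = y := by
  rw [inf_comm, inf_eq]
  have h : y ⊙ₘ ∼ₘ(x ⊙ₘ y) ⊕ₘ (x ⊙ₘ y) = y := sub_oplus_of_le (odot_le_right x y)
  rwa [neg_odot, oplus_comm (∼ₘx)] at h

/-- In the decomposition of `y` into `y ∧ ¬x` and `x ⊙ y`, the first summand equals `¬x ⊙ (x ⊕ y) =
¬x ⊙ x = 0`. -/
theorem odot_eq_right_of_oplus_eq_left {x y : M} (h : x ⊕ₘ y = x) : x ⊙ₘ y = y := by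
  have h1 := inf_neg_oplus x y
  rwa [inf_eq, neg_neg, h, odot_comm, odot_neg_self, zero_oplus] at h1

theorem disjoint_additive_zero {H : Type v} [AddCommGroup H] {s : M → H}
    (hs : ∀ a b, a ⊙ₘ b = zero → s (a ⊕ₘ b) = s a + s b) : s zero = 0 := by
  have := hs zero zero (odot_zero _)
  rwa [oplus_zero, left_eq_add] at this

/-- Functions that are additive on disjoint sums are valuations. -/
theorem disjoint_additive_oplus {H : Type v} [AddCommGroup H] {s : M → H}
    (hs : ∀ a b, a ⊙ₘ b = zero → s (a ⊕ₘ b) = s a + s b) (x y : M) :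
    s (x ⊕ₘ y) + s (x ⊙ₘ y) = s x + s y := by
  -- `x ⊕ y` is the disjoint sum of `x` and `y ∧ ¬x`; the latter recombines disjointly with `x ⊙ y`
  -- to give `y`.
  rw [← oplus_inf_neg, hs _ _ (odot_inf_neg x y), add_assoc, ← hs _ _ (inf_neg_odot x y),
    inf_neg_oplus]

end Valuations

/-! ### Good sequences as sums of one-term sequences, and the natural order. -/

namespace GoodSeq

variable {M : Type u} [MVAlgebra M]

theorem ext_val {a b : GoodSeq M} (h : ∀ i, a.1 i = b.1 i) : a = b := Subtype.ext (funext h)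

theorem single_val_zero (b : M) : (single b).1 0 = b := rfl

theorem single_val_succ (b : M) (i : ℕ) : (single b).1 (i + 1) = zero := rfl

theorem add_single_zero (a : GoodSeq M) (b : M) : (a + single b).1 0 = a.1 0 ⊕ₘ b := by
  rw [add_val, seqAdd, single_val_zero, osum, oplus_zero]

/-- Only the first term of the iterated sum involves a possibly nonzero entry of `(b)`: it is the
carry from position `i`. -/
theorem add_single_succ (a : GoodSeq M) (b : M) (i : ℕ) :
    (a + single b).1 (i + 1) = a.1 (i + 1) ⊕ₘ a.1 i ⊙ₘ b := by
  rw [add_val, seqAdd, single_val_succ, oplus_zero, osum_stable (n := 1) (by omega)]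
  · rw [osum, osum, zero_oplus, single_val_zero]; rfl
  · intro k hk _
    obtain ⟨k, rfl⟩ := Nat.exists_eq_add_of_le' hk
    rw [single_val_succ, odot_zero]

theorem antitone (a : GoodSeq M) : Antitone a.1 :=
  antitone_nat_of_succ_le fun i => by rw [← a.2.1 i]; exact le_oplus_left _ _

theorem oplus_eq_left (a : GoodSeq M) {i j : ℕ} (h : i < j) : a.1 i ⊕ₘ a.1 j = a.1 i := by
  refine le_antisymm ?_ (le_oplus_right _ _)
  conv_rhs => rw [← a.2.1 i]
  exact oplus_le_oplus le_rfl (a.antitone h)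

theorem odot_eq_right (a : GoodSeq M) {i j : ℕ} (h : i < j) : a.1 i ⊙ₘ a.1 j = a.1 j :=
  odot_eq_right_of_oplus_eq_left (a.oplus_eq_left h)

/-- The good sequence `(a₂, a₃, …)`. -/
def shift (a : GoodSeq M) : GoodSeq M :=
  ⟨fun i => a.1 (i + 1), fun i => a.2.1 (i + 1), by
    obtain ⟨n, hn⟩ := a.2.2
    exact ⟨n, fun i hi => hn _ (by omega)⟩⟩

theorem shift_val (a : GoodSeq M) (i : ℕ) : a.shift.1 i = a.1 (i + 1) := rfl

/-- Goodness gives `aᵢ₊₁ ⊙ a₀ = aᵢ₊₁` (indices from `0`), so each carry is the entry just dropped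
from its place, and it absorbs the next entry. -/
theorem shift_add_single (a : GoodSeq M) : a.shift + single (a.1 0) = a := by
  refine ext_val fun i => ?_
  cases i with
  | zero => rw [add_single_zero, shift_val, oplus_comm]; exact a.2.1 0
  | succ i =>
    rw [add_single_succ, shift_val, shift_val, odot_comm, a.odot_eq_right (Nat.succ_pos i),
      oplus_comm]
    exact a.2.1 (i + 1)

/-- The good sequences are generated by the sequences `(a)`. -/
theorem induction_single {p : GoodSeq M → Prop} (h0 : p 0)
    (h : ∀ a b, p a → p (a + single b)) (a : GoodSeq M) : p a := by
  -- The induction is on a bound for the length, which `shift` lowers by one.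
  obtain ⟨n, hn⟩ := a.2.2
  induction n generalizing a with
  | zero => exact (ext_val fun i => hn i (Nat.zero_le i) : a = 0) ▸ h0
  | succ n ih =>
    rw [← a.shift_add_single]
    exact h _ _ (ih _ fun i hi => hn _ (by omega))

theorem single_add_single_neg (b : M) : single b + single ∼ₘb = single one := by
  refine ext_val fun i => ?_
  rcases i with _ | _ | i
  · rw [add_single_zero, oplus_comm]; exact neg_oplus_self b
  · rw [add_single_succ, single_val_succ, single_val_zero, odot_neg_self, oplus_zero]; rfl
  · rw [add_single_succ, single_val_succ, single_val_succ, zero_odot, oplus_zero]; rfl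

/-- Subtraction of `(b)` is done by adding `(¬b)` and then removing `(1) = (b) + (¬b)`. The removal
is possible because `b ≤ a₀` makes the first entry of `a + (¬b)` equal to `1`. -/
theorem exists_add_single {a : GoodSeq M} {b : M} (h : b ≤ a.1 0) :
    ∃ c, c + single b = a := by
  refine ⟨(a + single ∼ₘb).shift, add_right_cancel (b := single ∼ₘb) ?_⟩
  rw [add_assoc, single_add_single_neg]
  have h1 : (a + single ∼ₘb).1 0 = one := by
    rw [add_single_zero, oplus_comm]
    exact oplus_eq_one.2 (by rwa [neg_neg])
  rw [← h1]; exact shift_add_single _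

/-- The order of the good sequences is the natural one. -/
theorem exists_add_of_le {a b : GoodSeq M} (h : b ≤ a) : ∃ c, c + b = a := by
  induction b using induction_single generalizing a with
  | h0 => exact ⟨a, add_zero a⟩
  | h b x ih =>
    -- The first entry of `b + (x)` is `b₀ ⊕ x ≥ x`, so `(x)` can be split off `a`; order
    -- cancellation then leaves `b ≤ c`.
    obtain ⟨c, rfl⟩ := exists_add_single (a := a) (b := x) (by
      refine le_trans ?_ (h 0)
      rw [add_single_zero]; exact le_oplus_left _ _)
    obtain ⟨d, rfl⟩ := ih (le_of_add_le_add_right h)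
    exact ⟨d, (add_assoc _ _ _).symm⟩

theorem eq_single_of_le {a : GoodSeq M} (h : a ≤ single one) : a = single (a.1 0) := by
  refine ext_val fun i => ?_
  cases i with
  | zero => rfl
  | succ i => exact eq_zero_of_le (h (i + 1))

/-! ### Additivity and monotonicity of the entrywise sum. -/

section Sum

variable {H : Type v} [AddCommGroup H] (s : M → H)

/-- The sum `∑ s (aᵢ)` over the entries of a good sequence. -/
noncomputable def sum (a : GoodSeq M) : H := ∑ᶠ i, s (a.1 i)

variable {s}

/-- A `finsum` takes the default value `0` on infinite support; `s 0 = 0` rules this out, since good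
sequences are eventually `0`. -/
theorem sum_eq_sum_range (h0 : s zero = 0) {a : GoodSeq M} {n : ℕ}
    (hn : ∀ i, n ≤ i → a.1 i = zero) : sum s a = ∑ i ∈ Finset.range n, s (a.1 i) := by
  refine finsum_eq_sum_of_support_subset _ fun i hi => ?_
  rw [Finset.coe_range, Set.mem_Iio]
  by_contra h
  exact hi ((congrArg s (hn i (not_lt.1 h))).trans h0)

theorem sum_zero (h0 : s zero = 0) : sum s (0 : GoodSeq M) = 0 := by
  rw [sum_eq_sum_range h0 (n := 0) fun _ _ => rfl, Finset.range_zero, Finset.sum_empty]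

theorem sum_add_single (hs : ∀ a b, a ⊙ₘ b = zero → s (a ⊕ₘ b) = s a + s b)
    (a : GoodSeq M) (b : M) : sum s (a + single b) = sum s a + s b := by
  have h0 := disjoint_additive_zero hs
  -- Up to position `n`, the two sums differ by `s b` except for the outgoing carry `aₙ ⊙ b`.
  have key : ∀ n, ∑ i ∈ Finset.range (n + 1), s ((a + single b).1 i) + s (a.1 n ⊙ₘ b) =
      ∑ i ∈ Finset.range (n + 1), s (a.1 i) + s b := by
    intro n
    induction n with
    | zero =>
      rw [Finset.sum_range_one, Finset.sum_range_one, add_single_zero,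
        disjoint_additive_oplus hs]
    | succ n ih =>
      -- The carry `aₙ ⊙ b` enters position `n + 1`. The overflow `aₙ₊₁ ⊙ aₙ ⊙ b` is just `aₙ₊₁ ⊙
      -- b`, the next carry.
      have h1 := disjoint_additive_oplus hs (a.1 (n + 1)) (a.1 n ⊙ₘ b)
      rw [← odot_assoc, odot_comm _ (a.1 n), a.odot_eq_right (Nat.lt_succ_self n)] at h1
      rw [Finset.sum_range_succ, Finset.sum_range_succ _ (n + 1), add_single_succ, add_assoc, h1,
        add_left_comm, add_right_comm, ← add_assoc, add_right_comm, add_assoc, ← ih]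
      abel
  obtain ⟨n, hn⟩ := a.2.2
  obtain ⟨m, hm⟩ := (a + single b).2.2
  -- At `n + m` both sequences have died out, so the last carry is `0`.
  have := key (n + m)
  rwa [hn (n + m) (by omega), zero_odot, h0, add_zero,
    ← sum_eq_sum_range h0 (fun i hi => hm i (by omega)),
    ← sum_eq_sum_range h0 (fun i hi => hn i (by omega))] at this

theorem sum_single (hs : ∀ a b, a ⊙ₘ b = zero → s (a ⊕ₘ b) = s a + s b) (b : M) :
    sum s (single b) = s b := by
  have := sum_add_single hs 0 b
  rwa [zero_add, sum_zero (disjoint_additive_zero hs), zero_add] at this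

theorem sum_add (hs : ∀ a b, a ⊙ₘ b = zero → s (a ⊕ₘ b) = s a + s b) (a b : GoodSeq M) :
    sum s (a + b) = sum s a + sum s b := by
  induction b using induction_single with
  | h0 => rw [add_zero, sum_zero (disjoint_additive_zero hs), add_zero]
  | h b x ih => rw [← add_assoc, sum_add_single hs, sum_add_single hs, ih, add_assoc]

/-- The sum over the entries, as a homomorphism of monoids. -/
noncomputable def sumHom (hs : ∀ a b, a ⊙ₘ b = zero → s (a ⊕ₘ b) = s a + s b) :
    GoodSeq M →+ H where
  toFun := sum s
  map_zero' := sum_zero (disjoint_additive_zero hs)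
  map_add' := sum_add hs

theorem sum_mono [PartialOrder H] [IsOrderedAddMonoid H]
    (hs : ∀ a b, a ⊙ₘ b = zero → s (a ⊕ₘ b) = s a + s b) (hpos : ∀ a, 0 ≤ s a)
    {a b : GoodSeq M} (h : a ≤ b) : sum s a ≤ sum s b := by
  obtain ⟨c, rfl⟩ := exists_add_of_le h
  rw [sum_add hs]
  refine le_add_of_nonneg_left ?_
  exact finsum_nonneg fun i => hpos _

end Sum

end GoodSeq

end MVAlgebra

/-! ### Existence and uniqueness of extensions of states. -/

namespace Xi

open MVAlgebra

variable {M : Type u} [MVAlgebra M] {H : Type v} [UnitalLGroup H]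

theorem mk_eq_sub (a b : GoodSeq M) : mk a b = mk a 0 - mk b 0 := by
  rw [sub_eq_add_neg, neg_mk, mk_add_mk, add_zero, zero_add]

theorem mk_add_single (a : GoodSeq M) (b : M) :
    mk (a + GoodSeq.single b) 0 = mk a 0 + of b := by
  rw [of_def, mk_add_mk, add_zero]

/-- A state on `Ξ M` is determined by its values on `M`. -/
theorem state_ext {t t' : LState (Xi M) H} (h : ∀ a : M, t (of a) = t' (of a)) : t = t' := by
  have h1 : ∀ a : GoodSeq M, t (mk a 0) = t' (mk a 0) := by
    intro a
    induction a using GoodSeq.induction_single with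
    | h0 => rw [← zero_def, t.map_zero, t'.map_zero]
    | h a b ih => rw [mk_add_single, t.map_add, t'.map_add, ih, h]
  refine LState.ext (funext fun x => ?_)
  induction x using Xi.ind with | h a b
  rw [mk_eq_sub, t.map_sub, t'.map_sub, h1, h1]

section Extend

variable {s : M → H} (hs : ∀ a b, a ⊙ₘ b = MVAlgebra.zero → s (a ⊕ₘ b) = s a + s b)
  (hpos : ∀ a, 0 ≤ s a) (hone : s MVAlgebra.one = UnitalLGroup.unit)

/-- The additive extension `[a, b] ↦ ∑ s (aᵢ) - ∑ s (bᵢ)`. -/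
noncomputable def extendHom : Xi M →+ H :=
  Algebra.GrothendieckAddGroup.lift (GoodSeq.sumHom hs)

theorem extendHom_mk (a b : GoodSeq M) :
    extendHom hs (mk a b) = GoodSeq.sum s a - GoodSeq.sum s b := by
  have h0 : ∀ c : GoodSeq M, extendHom hs (mk c 0) = GoodSeq.sum s c := fun c =>
    AddSubmonoid.LocalizationMap.lift_eq _ _ c
  rw [mk_eq_sub, _root_.map_sub, h0, h0]

theorem extendHom_of (a : M) : extendHom hs (of a) = s a := by
  rw [of_def, extendHom_mk, GoodSeq.sum_single hs, GoodSeq.sum_zero (disjoint_additive_zero hs),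
    sub_zero]

/-- The extension to a state of a positive normalised function additive on disjoint sums. -/
noncomputable def extend : LState (Xi M) H where
  toFun := extendHom hs
  map_add := (extendHom hs).map_add
  map_nonneg x hx := by
    induction x using Xi.ind with | h a b
    rw [zero_def, mk_le_mk, add_zero, zero_add] at hx
    rw [extendHom_mk]
    exact sub_nonneg.2 (GoodSeq.sum_mono hs hpos hx)
  map_unit := by rw [← of_one, extendHom_of, hone]

theorem extend_of (a : M) : extend hs hpos hone (of a) = s a := extendHom_of hs a

end Extend

/-! ### The unit interval of `Ξ M`. -/

theorem of_nonneg (a : M) : 0 ≤ of a := (phi a).nonneg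

theorem of_injective : Function.Injective (of : M → Xi M) := by
  intro a b h
  rw [of_def, of_def, mk_eq_mk, add_zero, add_zero] at h
  exact congrArg (fun c : GoodSeq M => c.1 0) h

theorem phi_injective : Function.Injective (phi : M → Gamma (Xi M)) :=
  fun _ _ h => of_injective (congrArg Gamma.val h)

/-- A nonnegative difference is the class of a single good sequence `c`, by the natural order. The
bound by the unit says `c ≤ (1)`, which forces all entries of `c` after the first to vanish. -/
theorem phi_surjective : Function.Surjective (phi : M → Gamma (Xi M)) := by
  rintro ⟨x, h0, h1⟩
  induction x using Xi.ind with | h a b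
  rw [zero_def, mk_le_mk, add_zero, zero_add] at h0
  obtain ⟨c, rfl⟩ := GoodSeq.exists_add_of_le h0
  have e : mk (c + b) b = mk c 0 := mk_eq_mk.2 (add_zero _)
  refine ⟨c.1 0, Gamma.ext ?_⟩
  change of (c.1 0) = mk (c + b) b
  rw [e] at h1 ⊢
  have h2 : mk c 0 ≤ mk (GoodSeq.single MVAlgebra.one) 0 := h1
  rw [mk_le_mk, zero_add, zero_add] at h2
  rw [of_def, ← GoodSeq.eq_single_of_le h2]

end Xi

/-- The additivity condition on a state is exactly what the extension requires of `a ↦ [(s a),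
(0)]`, viewed as a map from `M` into the group `Ξ N`. -/
theorem uniqueStateExtension : UniqueStateExtension.{u} := by
  intro M N _ _ s
  refine ⟨Xi.extend (s := fun a => Xi.of (s a)) s.map_oplus (fun a => Xi.of_nonneg _)
    (by rw [s.map_one, Xi.of_one]), fun a => Xi.extend_of _ _ _ a, fun t ht => Xi.state_ext ?_⟩
  intro a
  rw [ht, Xi.extend_of]

namespace Xi

open MVAlgebra

variable (M : Type u) [MVAlgebra M]

/-- The map `φ_M` as a state. -/
def phiState : MVState M (Gamma (Xi M)) where
  toFun := phi
  map_one := Gamma.ext (by rw [Gamma.one_val]; exact of_one)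
  map_oplus a b hab := by
    have h : of (a ⊕ₘ b) = of a + of b := of_add_of_eq_iff.2 ⟨hab, rfl⟩
    have h1 : of a + of b ≤ UnitalLGroup.unit := h ▸ (phi (a ⊕ₘ b)).le_unit
    rw [of_add_of_eq_iff, Gamma.odot_eq_zero_iff]
    refine ⟨h1, Gamma.ext ?_⟩
    rw [Gamma.oplus_val]
    exact h.trans (inf_eq_left.2 h1).symm

/-- The inverse of `φ_M` as a state. -/
noncomputable def phiInvState : MVState (Gamma (Xi M)) M where
  toFun := Function.surjInv phi_surjective
  map_one := phi_injective (by
    rw [Function.surjInv_eq phi_surjective]; exact (phiState M).map_one.symm)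
  map_oplus x y hxy := by
    -- Embedded in `Ξ M`, the preimage of `z` is `z` itself, so the state condition becomes
    -- additivity of disjoint sums in the unit interval.
    have h : ∀ z : Gamma (Xi M), of (Function.surjInv phi_surjective z) = z.val := fun z =>
      congrArg Gamma.val (Function.surjInv_eq phi_surjective z)
    rw [h, h, h, Gamma.oplus_val_of_odot hxy]

end Xi

/-! ### The isomorphism between `Ξ Γ G` and `G`. -/

namespace Gamma

open MVAlgebra

variable (G : Type u) [UnitalLGroup G]

/-- The state `Ξ Γ G → G` that extends the inclusion of the unit interval. -/
noncomputable def counit : LState (Xi (Gamma G)) G :=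
  Xi.extend (s := Gamma.val) (fun _ _ h => oplus_val_of_odot h) Gamma.nonneg one_val

variable {G}

theorem counit_of (a : Gamma G) : counit G (Xi.of a) = a.val := Xi.extend_of _ _ _ a

theorem counit_shift (a : GoodSeq (Gamma G)) :
    counit G (Xi.mk a 0) = counit G (Xi.mk a.shift 0) + (a.1 0).val := by
  conv_lhs => rw [← a.shift_add_single, Xi.mk_add_single, (counit G).map_add, counit_of]

/-- This generalises `counit_inf_unit` to make induction on the length possible: the absorbing
element `x` stays fixed while entries are removed from `a`. -/
theorem add_counit_inf_unit {x : Gamma G} {a : GoodSeq (Gamma G)} (h : ∀ i, x ⊕ₘ a.1 i = x) :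
    (x.val + counit G (Xi.mk a 0)) ⊓ UnitalLGroup.unit = x.val := by
  obtain ⟨n, hn⟩ := a.2.2
  induction n generalizing a with
  | zero =>
    have : a = 0 := GoodSeq.ext_val fun i => hn i (Nat.zero_le i)
    rw [this, ← Xi.zero_def, LState.map_zero, add_zero]
    exact inf_eq_left.2 x.le_unit
  | succ n ih =>
    have h0 := congrArg Gamma.val (h 0)
    have h1 := ih (a := a.shift) (fun i => h (i + 1)) (fun i hi => hn _ (by omega))
    have hle : (UnitalLGroup.unit : G) ≤ UnitalLGroup.unit + (a.1 0).val :=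
      le_add_of_nonneg_right (a.1 0).nonneg
    rw [oplus_val] at h0
    -- Replacing `1` by `(1 + a₀) ∧ 1` allows the sum without `a₀` to be truncated first; it
    -- collapses to `x`, and `(x + a₀) ∧ 1 = x` remains.
    rw [counit_shift, ← add_assoc, ← inf_eq_right.2 hle, ← inf_assoc, ← inf_add, h1, h0]

theorem counit_inf_unit (a : GoodSeq (Gamma G)) :
    counit G (Xi.mk a 0) ⊓ UnitalLGroup.unit = (a.1 0).val := by
  rw [counit_shift, add_comm]
  exact add_counit_inf_unit fun i => a.oplus_eq_left (Nat.succ_pos i)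

/-- Dropping the first entry subtracts `g ∧ 1` from the image `g`, and `g - g ∧ 1 = 0 ∨ (g - 1)`. -/
theorem counit_shift_eq (a : GoodSeq (Gamma G)) :
    counit G (Xi.mk a.shift 0) = 0 ⊔ (counit G (Xi.mk a 0) - UnitalLGroup.unit) := by
  have h := counit_shift a
  rw [← counit_inf_unit a] at h
  rw [← sub_eq_iff_eq_add.2 h, sub_eq_add_neg, neg_inf, add_sup, add_neg_cancel, ← sub_eq_add_neg]

theorem le_of_val_le {x y : Gamma G} (h : x.val ≤ y.val) : x ≤ y := by
  rw [← MVAlgebra.sub_eq_zero, odot_eq_zero_iff, neg_val]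
  rw [← add_sub_assoc, add_comm, add_sub_assoc, add_le_iff_nonpos_right]
  exact sub_nonpos.2 h

/-- The first entry is obtained from the image by the monotone map `g ↦ g ∧ 1`, and the image of the
shift by the monotone map `g ↦ 0 ∨ (g - 1)`. Induction along the positions compares all entries. -/
theorem le_of_counit_mk_le {a b : GoodSeq (Gamma G)}
    (h : counit G (Xi.mk a 0) ≤ counit G (Xi.mk b 0)) : a ≤ b := by
  intro i
  induction i generalizing a b with
  | zero =>
    refine le_of_val_le ?_
    rw [← counit_inf_unit, ← counit_inf_unit]
    exact inf_le_inf_right _ h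
  | succ i ih =>
    refine ih (a := a.shift) (b := b.shift) ?_
    rw [counit_shift_eq, counit_shift_eq]
    exact sup_le_sup_left (sub_le_sub_right h _) _

/-- Reflecting the order yields both injectivity of `counit` and positivity of its inverse. A common
subtrahend reduces the claim to good sequences. -/
theorem le_of_counit_le {x y : Xi (Gamma G)} (h : counit G x ≤ counit G y) : x ≤ y := by
  obtain ⟨a, b, c, rfl, rfl⟩ := Xi.exists_common x y
  rw [Xi.mk_eq_sub a, Xi.mk_eq_sub b, LState.map_sub, LState.map_sub, sub_le_sub_iff_right] at h
  exact Xi.mk_le_mk.2 (add_le_add_right (le_of_counit_mk_le h) c)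

theorem counit_injective : Function.Injective (counit G) := fun _ _ h =>
  le_antisymm (le_of_counit_le h.le) (le_of_counit_le h.ge)

/-- Induction on `n` with `g ≤ n • 1`: the piece `g ∧ 1` lies in `Γ G`, and the remainder `g - g ∧ 1
= 0 ∨ (g - 1)` is at most `(n - 1) • 1`. -/
theorem exists_counit_eq_of_nonneg {g : G} (hg : 0 ≤ g) : ∃ x, counit G x = g := by
  obtain ⟨n, hn⟩ := UnitalLGroup.exists_le_nsmul_unit g
  induction n generalizing g with
  | zero =>
    rw [zero_nsmul] at hn
    exact ⟨0, by rw [LState.map_zero, le_antisymm hn hg]⟩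
  | succ n ih =>
    obtain ⟨x, hx⟩ := ih (g := g - g ⊓ UnitalLGroup.unit) (sub_nonneg.2 inf_le_left) (by
      rw [sub_eq_add_neg, neg_inf, add_sup, add_neg_cancel, ← sub_eq_add_neg]
      refine sup_le (nsmul_nonneg UnitalLGroup.unit_nonneg n) ?_
      rwa [sub_le_iff_le_add, ← succ_nsmul])
    refine ⟨x + Xi.of ⟨g ⊓ UnitalLGroup.unit, le_inf hg UnitalLGroup.unit_nonneg, inf_le_right⟩, ?_⟩
    rw [LState.map_add, hx, counit_of, sub_add_cancel]

theorem counit_surjective : Function.Surjective (counit G) := by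
  intro g
  obtain ⟨x, hx⟩ := exists_counit_eq_of_nonneg (le_sup_right : 0 ≤ g ⊔ 0)
  obtain ⟨y, hy⟩ := exists_counit_eq_of_nonneg (sub_nonneg.2 (le_sup_left : g ≤ g ⊔ 0))
  -- Every `g` is the difference of the nonnegative elements `g ∨ 0` and `g ∨ 0 - g`.
  exact ⟨x - y, by rw [LState.map_sub, hx, hy, sub_sub_cancel]⟩

variable (G)

/-- The inverse `ϵ_G : G → Ξ Γ G` of the counit. -/
noncomputable def counitInv : LState G (Xi (Gamma G)) where
  toFun := Function.surjInv counit_surjective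
  map_add a b := counit_injective (by simp only [LState.map_add, Function.surjInv_eq counit_surjective])
  map_nonneg a ha := le_of_counit_le (by rwa [LState.map_zero, Function.surjInv_eq counit_surjective])
  map_unit := counit_injective (by rw [Function.surjInv_eq counit_surjective, LState.map_unit])

variable {G}

theorem counit_counitInv (g : G) : counit G (counitInv G g) = g :=
  Function.surjInv_eq counit_surjective g

theorem counitInv_counit (x : Xi (Gamma G)) : counitInv G (counit G x) = x :=
  counit_injective (counit_counitInv _)

end Gamma

/-! ### The functors and the equivalence. -/

/-- The property that characterises the chosen extension; the later arguments about `XiState` on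
morphisms rest on it. -/
theorem XiState_map_of (h : UniqueStateExtension.{u}) {M N : MVStateCat.{u}} (s : M ⟶ N)
    (a : M.carrier) :
    LState.toFun ((XiState h).map s) (Xi.of a) = Xi.of (MVState.toFun s a) :=
  (h M.carrier N.carrier s).choose_spec.1 a

/-- The natural isomorphism `M ≅ Γ Ξ M`. -/
noncomputable def unitIso (h : UniqueStateExtension.{u}) :
    𝟭 MVStateCat.{u} ≅ XiState h ⋙ GammaState :=
  NatIso.ofComponents
    (fun M =>
      { hom := Xi.phiState M.carrier
        inv := Xi.phiInvState M.carrier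
        hom_inv_id := MVState.ext (funext fun _ =>
          Xi.phi_injective (Function.surjInv_eq Xi.phi_surjective _))
        inv_hom_id := MVState.ext (funext fun x => Function.surjInv_eq Xi.phi_surjective x) })
    fun {_ _} s => MVState.ext (funext fun a => Gamma.ext (XiState_map_of h s a).symm)

/-- The natural isomorphism `Ξ Γ G ≅ G`. -/
noncomputable def counitIso (h : UniqueStateExtension.{u}) :
    GammaState ⋙ XiState h ≅ 𝟭 LGroupStateCat.{u} :=
  NatIso.ofComponents
    (fun G =>
      { hom := Gamma.counit G.carrier
        inv := Gamma.counitInv G.carrier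
        hom_inv_id := LState.ext (funext fun x => Gamma.counitInv_counit x)
        inv_hom_id := LState.ext (funext fun g => Gamma.counit_counitInv g) })
    -- Both sides of the naturality square are states on `Ξ Γ G`; on an element `a` of `Γ G` each
    -- gives the value of `s` at `a`.
    fun {G H} s => Xi.state_ext (M := Gamma G.carrier) (H := H.carrier) fun a =>
      (congrArg (Gamma.counit H.carrier) (XiState_map_of h (GammaState.map s) a)).trans <|
        (Gamma.counit_of (G := H.carrier) _).trans
          (congrArg (LState.toFun s) (Gamma.counit_of a)).symm

theorem incl_comp_XiState (h : UniqueStateExtension.{u}) :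
    MVCat.incl ⋙ XiState h = XiHom ⋙ LGroupCat.incl := by
  -- The object maps agree definitionally, so only an equality of states on `Ξ M` is left, to be
  -- checked on `M`.
  refine CategoryTheory.Functor.hext (fun _ => rfl) fun M N f => heq_of_eq ?_
  refine Xi.state_ext (M := M.carrier) (H := Xi N.carrier) fun a => ?_
  refine (XiState_map_of h (MVCat.incl.map f) a).trans ?_
  change Xi.of (MVHom.toFun f a) = Xi.mapFun f (Xi.mk _ _)
  rw [Xi.mapFun_mk, Xi.single_zero, _root_.map_zero, Xi.of_def]
  congr 1
  refine MVAlgebra.GoodSeq.ext_val fun i => ?_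
  cases i with
  | zero => rfl
  | succ i => exact (MVHom.map_zero f).symm

theorem theorem2p5 :
    ∃ h : UniqueStateExtension.{u},
      MVCat.incl ⋙ XiState h = XiHom ⋙ LGroupCat.incl ∧
      LGroupCat.incl ⋙ GammaState = GammaHom.{u} ⋙ MVCat.incl ∧
      ∃ (e : MVStateCat.{u} ≌ LGroupStateCat.{u})
        (η : 𝟭 MVStateCat.{u} ≅ XiState h ⋙ GammaState)
        (ε : GammaState ⋙ XiState h ≅ 𝟭 LGroupStateCat.{u})
        (hηε : ∀ M : MVStateCat.{u},
          (XiState h).map (η.hom.app M) ≫ ε.hom.app ((XiState h).obj M) =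
            𝟙 ((XiState h).obj M)),
        e = Equivalence.mk' (XiState h) GammaState η ε hηε ∧
        (∀ (M : MVStateCat.{u}) (a : M.carrier),
          MVState.toFun (η.hom.app M) a = Xi.phi a) ∧
        (∀ (G : LGroupStateCat.{u}) (a : Gamma G.carrier),
          LState.toFun (ε.inv.app G) a.val = Xi.of a) := by
  refine ⟨uniqueStateExtension, incl_comp_XiState _, rfl, _, unitIso _, counitIso _, fun M => ?_,
    rfl, fun M a => rfl, fun G a => ?_⟩
  -- The triangle identity is tested on `M`: `a` goes to the class of `φ a` in `Ξ Γ Ξ M`, which the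
  -- counit sends back to the underlying element `[(a), (0)]`.
  · refine Xi.state_ext (M := M.carrier) (H := Xi M.carrier) fun a => ?_
    refine (congrArg (Gamma.counit (Xi M.carrier)) (XiState_map_of uniqueStateExtension
      ((unitIso uniqueStateExtension).hom.app M) a)).trans ?_
    exact Gamma.counit_of (G := Xi M.carrier) (Xi.phi a)
  -- The counit sends `[(a), (0)]` to `a`, so its inverse must send `a` to `[(a), (0)]`.
  · refine (congrArg (Gamma.counitInv G.carrier) (Gamma.counit_of a).symm).trans ?_
    exact Gamma.counitInv_counit _
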